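/- Let $K=\mathbb{C}((\hbar))$, let $\overline K$ be an algebraic closure of $K$, and let $\sqrt\hbar\in\overline K$ be a square root of $\hbar$. Let $\mathfrak g$ be a finite-dimensional simple complex Lie algebra and write $\mathfrak g(F)=F\otimes_{\mathbb C}\mathfrak g$ for a field $F\supseteq\mathbb{C}$. Let $G$ be a linear algebraic group over $\mathbb{C}$ corresponding to $\mathfrak g$, i.e. with an identification $[\mathrm{Lie}\,G,\mathrm{Lie}\,G]\simeq\mathfrak g$ (for instance $\mathrm{Lie}\,G\simeq\mathfrak g$, or $G=GL_n$ and $\mathfrak g=\mathfrak{sl}_n$); then $G(\overline K)$ acts on $\mathfrak g(\overline K)$, and on its tensor square, by $\mathrm{Ad}$, and $\mathrm{Gal}(\overline K/K)$ acts on $G(\overline K)$. Let $r_{BD}$ be an $r$-matrix of the Belavin–Drinfeld list, defined over $K$, as follows. Fix a nondegenerate invariant symmetric bilinear form on $\mathfrak g$, a Cartan subalgebra $\mathfrak h\subset\mathfrak g$ with an orthonormal basis $(t_k)$, a set $\Gamma$ of simple roots, subsets $\Gamma_1,\Gamma_2\subseteq\Gamma$, and an isometric bijection $\tau:\Gamma_1\to\Gamma_2$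 such that for each $\alpha\in\Gamma_1$ some iterate $\tau^k(\alpha)$ is defined and lies in $\Gamma_2\setminus\Gamma_1$; extend $\tau$ additively to the roots in $\mathrm{Span}(\Gamma_1)$. Choose root vectors $e_\alpha$ with $(e_\alpha,e_{-\alpha})=1$ such that $e_\alpha\mapsto e_{\tau(\alpha)}$, for roots $\alpha\in\mathrm{Span}(\Gamma_1)$, extends to an isomorphism of the subalgebras generated by the root vectors of $\pm\Gamma_1$ and of $\pm\Gamma_2$. Let $r_0\in\mathfrak h(K)\otimes_K\mathfrak h(K)$ satisfy $r_0+r_0^{21}=\sum_k t_k\otimes t_k$ and $(\tau(\alpha)\otimes\mathrm{id}+\mathrm{id}\otimes\alpha)r_0=0$ for all $\alpha\in\Gamma_1$. Then $$r_{BD}=r_0+\sum_{\alpha>0}e_{-\alpha}\otimes e_\alpha+\sum_{\alpha\in\mathrm{Span}(\Gamma_1)^+}\ \sum_{k\ge1}e_{-\alpha}\wedge e_{\tau^k(\alpha)},\qquad x\wedge y=x\otimes y-y\otimes x,$$ the inner sum being over those $k\ge 1$ for which $\tau^k(\alpha)$ is defined. Let $a=\kappa\sqrt\hbar$ with $\kappa\in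 K^\times$, and let $X\in G(\overline K)$. Then $a\,\mathrm{Ad}_X r_{BD}$ defines a Lie bialgebra structure on $\mathfrak g(K)$ (that is, $x\mapsto[x\otimes1+1\otimes x,\;a\,\mathrm{Ad}_Xr_{BD}]$ maps $\mathfrak g(K)$ to $\mathfrak g(K)\otimes_K\mathfrak g(K)$, and is a Lie cobracket making $\mathfrak g(K)$ a Lie bialgebra) if and only if the following two conditions hold: 1. $X$ is a non-twisted Belavin–Drinfeld cocycle over the field $K[\sqrt\hbar]$: $\mathrm{Ad}_{X^{-1}\sigma(X)}r_{BD}=r_{BD}$ for every $\sigma\in\mathrm{Gal}(\overline K/K[\sqrt\hbar])$; 2. $\mathrm{Ad}_{X^{-1}\sigma_0(X)}r_{BD}=r_{BD}^{21}$, where $\sigma_0$ is the non-trivial element of $\mathrm{Gal}(K[\sqrt\hbar]/K)$, extended to an arbitrary (fixed) automorphism of $\overline K$ in order to act on $X$. -/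

import Mathlib

open scoped TensorProduct
open IntermediateField

noncomputable section

namespace TwistedBD

/-! ### The fields -/

/-- The field `ℂ((ħ))` of formal Laurent series. -/
abbrev K : Type := LaurentSeries ℂ

/-- An algebraic closure of `ℂ((ħ))`. -/
abbrev Kbar : Type := AlgebraicClosure K

/-- The formal parameter `ħ ∈ ℂ((ħ))`. -/
def hbar : K := HahnSeries.single (1 : ℤ) (1 : ℂ)

/-! ### Lie bialgebras -/

section Bialgebra

variable (F L : Type*) [Field F] [LieRing L] [LieAlgebra F L]

/-- The cyclic permutation `x ⊗ (y ⊗ z) ↦ y ⊗ (z ⊗ x)`. -/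
def cyc : L ⊗[F] (L ⊗[F] L) →ₗ[F] L ⊗[F] (L ⊗[F] L) :=
  (TensorProduct.assoc F L L L).toLinearMap ∘ₗ (TensorProduct.comm F L (L ⊗[F] L)).toLinearMap

/-- `δ : L → L ⊗ L` is a Lie bialgebra structure (a Lie cobracket) on the Lie algebra `L`:
it is skew-symmetric, satisfies the co-Jacobi identity, and is a 1-cocycle. -/
structure IsLieCobracket (δ : L →ₗ[F] L ⊗[F] L) : Prop where
  skew : ∀ x, TensorProduct.comm F L L (δ x) = -δ x
  coJacobi : ∀ x, δ.lTensor L (δ x) + cyc F L (δ.lTensor L (δ x))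
    + cyc F L (cyc F L (δ.lTensor L (δ x))) = 0
  cocycle : ∀ x y : L, δ ⁅x, y⁆ = ⁅x, δ y⁆ - ⁅y, δ x⁆

end Bialgebra

/-! ### Extension of scalars from `F` to `E` of `F ⊗ 𝔤` and of its tensor square -/

section Scalars

variable (F E : Type*) [Field F] [Field E] [Algebra ℂ F] [Algebra ℂ E] [Algebra F E]
  [IsScalarTower ℂ F E] (𝔤 : Type*) [LieRing 𝔤] [LieAlgebra ℂ 𝔤]

/-- The inclusion `𝔤(F) → 𝔤(E)`, `x ⊗ y ↦ x ⊗ y`. -/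
def ext₁ : F ⊗[ℂ] 𝔤 →ₗ[F] E ⊗[ℂ] 𝔤 :=
  TensorProduct.AlgebraTensorModule.map (Algebra.linearMap F E) LinearMap.id

/-- The inclusion `𝔤(F) ⊗_F 𝔤(F) → 𝔤(E) ⊗_E 𝔤(E)`. -/
def ext₂ : (F ⊗[ℂ] 𝔤) ⊗[F] (F ⊗[ℂ] 𝔤) →ₗ[F] (E ⊗[ℂ] 𝔤) ⊗[E] (E ⊗[ℂ] 𝔤) :=
  TensorProduct.lift <| LinearMap.mk₂ F (fun x y => ext₁ F E 𝔤 x ⊗ₜ[E] ext₁ F E 𝔤 y)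
    (fun x x' y => by rw [map_add, TensorProduct.add_tmul])
    (fun c x y => by rw [map_smul, TensorProduct.smul_tmul'])
    (fun x y y' => by rw [map_add, TensorProduct.tmul_add])
    (fun c x y => by rw [map_smul, ← algebraMap_smul E c (ext₁ F E 𝔤 y),
      TensorProduct.tmul_smul, algebraMap_smul])

/-- The tensor `t ∈ 𝔤(E) ⊗_E 𝔤(E)` defines a Lie bialgebra structure on `𝔤(F)`: the coboundary
`x ↦ [x ⊗ 1 + 1 ⊗ x, t]` maps `𝔤(F)` to `𝔤(F) ⊗_F 𝔤(F)`, and the resulting map is a Lie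
bialgebra structure on the Lie algebra `𝔤(F)` over `F`. -/
def DefinesLieBialgebra (t : (E ⊗[ℂ] 𝔤) ⊗[E] (E ⊗[ℂ] 𝔤)) : Prop :=
  ∃ δ : F ⊗[ℂ] 𝔤 →ₗ[F] (F ⊗[ℂ] 𝔤) ⊗[F] (F ⊗[ℂ] 𝔤),
    IsLieCobracket F (F ⊗[ℂ] 𝔤) δ ∧ ∀ x, ext₂ F E 𝔤 (δ x) = ⁅ext₁ F E 𝔤 x, t⁆

end Scalars

/-! ### Linear algebraic groups over `ℂ`, their Lie algebras, and the adjoint action -/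

/-- The matrix `M` satisfies the polynomial equations `eqs` in the matrix entries. -/
def Vanishes {n : ℕ} (eqs : Set (MvPolynomial (Fin n × Fin n) ℂ)) {R : Type} [CommRing R]
    [Algebra ℂ R] (M : Matrix (Fin n) (Fin n) R) : Prop :=
  ∀ f ∈ eqs, MvPolynomial.aeval (fun p : Fin n × Fin n => M p.1 p.2) f = 0

/-- A linear algebraic group over `ℂ`: a closed subgroup scheme of `GL_n`, given by polynomial
equations whose invertible solutions form a group over every commutative `ℂ`-algebra. -/
structure LinAlgGroup (n : ℕ) where
  eqs : Set (MvPolynomial (Fin n × Fin n) ℂ)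
  one_mem : ∀ (R : Type) [CommRing R] [Algebra ℂ R],
    Vanishes eqs (1 : Matrix (Fin n) (Fin n) R)
  mul_mem : ∀ (R : Type) [CommRing R] [Algebra ℂ R] (X Y : GL (Fin n) R),
    Vanishes eqs X.val → Vanishes eqs Y.val → Vanishes eqs (X * Y).val
  inv_mem : ∀ (R : Type) [CommRing R] [Algebra ℂ R] (X : GL (Fin n) R),
    Vanishes eqs X.val → Vanishes eqs (X⁻¹).val

namespace LinAlgGroup

variable {n : ℕ} (G : LinAlgGroup n)

/-- The group `G(R)` of `R`-points. -/
def points (R : Type) [CommRing R] [Algebra ℂ R] : Subgroup (GL (Fin n) R) where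
  carrier := {X | Vanishes G.eqs X.val}
  one_mem' := G.one_mem R
  mul_mem' := fun {X Y} hX hY => G.mul_mem R X Y hX hY
  inv_mem' := fun {X} hX => G.inv_mem R X hX

theorem vanishes_map {eqs : Set (MvPolynomial (Fin n × Fin n) ℂ)} {R S : Type} [CommRing R]
    [Algebra ℂ R] [CommRing S] [Algebra ℂ S] (φ : R →ₐ[ℂ] S) {M : Matrix (Fin n) (Fin n) R}
    (hM : Vanishes eqs M) : Vanishes eqs (M.map φ) := by
  intro f hf
  have h := congrArg φ (hM f hf)
  rw [map_zero, ← AlgHom.comp_apply, MvPolynomial.comp_aeval] at h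
  exact h

/-- The homomorphism `G(R) → G(S)` induced by a homomorphism `R → S` of `ℂ`-algebras
(apply it to each matrix entry). For an automorphism `σ` of `R` this is `X ↦ σ(X)`. -/
def mapPoints {R S : Type} [CommRing R] [Algebra ℂ R] [CommRing S] [Algebra ℂ S]
    (φ : R →ₐ[ℂ] S) : G.points R →* G.points S :=
  ((Matrix.GeneralLinearGroup.map (n := Fin n) φ.toRingHom).comp (G.points R).subtype).codRestrict
    (G.points S) fun X => vanishes_map φ X.2

/-- The tangent space at the identity of `G` over `R`: the matrices `y` with
`1 + ε y ∈ G(R[ε])`, `ε² = 0`; here `TrivSqZeroExt.inr r` is the element `ε r` of `R[ε]`.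
For `R = ℂ` this is the Lie algebra of `G`. -/
def tangent (R : Type) [CommRing R] [Algebra ℂ R] : Set (Matrix (Fin n) (Fin n) R) :=
  {y | Vanishes G.eqs (R := DualNumber R)
    (1 + y.map TrivSqZeroExt.inr)}

/-- The derived algebra `[Lie G, Lie G]` of the Lie algebra `Lie G ⊆ 𝔤𝔩_n(ℂ)`. -/
def derivedLie : Submodule ℂ (Matrix (Fin n) (Fin n) ℂ) :=
  Submodule.span ℂ {z | ∃ x ∈ G.tangent ℂ, ∃ y ∈ G.tangent ℂ, x * y - y * x = z}

/-- `G` is an algebraic group corresponding to the simple Lie algebra `𝔤`: an identification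
of `𝔤` with `[Lie G, Lie G]`. This includes all `G` with `Lie G ≃ 𝔤` (as then
`[Lie G, Lie G] = Lie G`), and `G = GL_n` for `𝔤 = 𝔰𝔩_n`. -/
structure Corresponds (𝔤 : Type*) [LieRing 𝔤] [LieAlgebra ℂ 𝔤] where
  ι : 𝔤 →ₗ[ℂ] Matrix (Fin n) (Fin n) ℂ
  map_lie : ∀ x y, ι ⁅x, y⁆ = ι x * ι y - ι y * ι x
  injective : Function.Injective ι
  range_eq : LinearMap.range ι = G.derivedLie

theorem aeval_dual {σ : Type} [Fintype σ] {R : Type} [CommRing R] [Algebra ℂ R]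
    (c y : σ → R) (f : MvPolynomial σ ℂ) :
    MvPolynomial.aeval (R := ℂ) (S₁ := DualNumber R)
      (fun i => TrivSqZeroExt.inl (c i) + TrivSqZeroExt.inr (y i)) f
    = TrivSqZeroExt.inl (MvPolynomial.aeval c f)
      + TrivSqZeroExt.inr (∑ i, MvPolynomial.aeval c (MvPolynomial.pderiv i f) * y i) := by
  classical
  induction f using MvPolynomial.induction_on with
  | C a =>
    rw [MvPolynomial.aeval_C, MvPolynomial.aeval_C]
    simp only [MvPolynomial.pderiv_C, map_zero, zero_mul, Finset.sum_const_zero,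
      TrivSqZeroExt.inr_zero, add_zero]
    rfl
  | add p q hp hq =>
    rw [map_add, hp, hq]
    simp only [map_add, add_mul, Finset.sum_add_distrib, TrivSqZeroExt.inl_add,
      TrivSqZeroExt.inr_add]
    abel
  | mul_X p i hp =>
    rw [map_mul, hp, MvPolynomial.aeval_X]
    have h : ∀ j, MvPolynomial.aeval c (MvPolynomial.pderiv j (p * MvPolynomial.X i)) * y j
        = c i * (MvPolynomial.aeval c (MvPolynomial.pderiv j p) * y j)
          + (if i = j then MvPolynomial.aeval c p * y j else 0) := by
      intro j
      rw [MvPolynomial.pderiv_mul, MvPolynomial.pderiv_X]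
      by_cases hij : i = j
      · subst hij
        simp
        ring
      · simp [hij]
        ring
    simp only [h, Finset.sum_add_distrib, ← Finset.mul_sum, Finset.sum_ite_eq, Finset.mem_univ,
      if_true]
    ext
    · simp
    · simp
      ring

theorem mem_tangent_iff {R : Type} [CommRing R] [Algebra ℂ R] (y : Matrix (Fin n) (Fin n) R) :
    y ∈ G.tangent R ↔ ∀ f ∈ G.eqs, ∑ p : Fin n × Fin n,
      (MvPolynomial.aeval (fun q : Fin n × Fin n => (1 : Matrix (Fin n) (Fin n) ℂ) q.1 q.2)
        (MvPolynomial.pderiv p f)) • y p.1 p.2 = 0 := by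
  refine forall₂_congr fun f hf => ?_
  have h1 : (fun p : Fin n × Fin n => ((1 : Matrix (Fin n) (Fin n) (DualNumber R))
      + y.map (TrivSqZeroExt.inr : R → DualNumber R)) p.1 p.2)
      = fun p => TrivSqZeroExt.inl ((1 : Matrix (Fin n) (Fin n) R) p.1 p.2)
        + TrivSqZeroExt.inr (y p.1 p.2) := by
    funext p
    by_cases h : p.1 = p.2
    · simp [h, Matrix.one_apply]
    · simp [h]
  have h2 : (fun q : Fin n × Fin n => (1 : Matrix (Fin n) (Fin n) R) q.1 q.2)
      = fun q => Algebra.ofId ℂ R ((1 : Matrix (Fin n) (Fin n) ℂ) q.1 q.2) := by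
    funext q
    by_cases h : q.1 = q.2 <;> simp [h, Matrix.one_apply]
  have h3 : ∀ g : MvPolynomial (Fin n × Fin n) ℂ,
      MvPolynomial.aeval (fun q : Fin n × Fin n => (1 : Matrix (Fin n) (Fin n) R) q.1 q.2) g
      = algebraMap ℂ R (MvPolynomial.aeval
        (fun q : Fin n × Fin n => (1 : Matrix (Fin n) (Fin n) ℂ) q.1 q.2) g) := by
    intro g
    rw [h2]
    exact (MvPolynomial.comp_aeval_apply (B := R) _ (Algebra.ofId ℂ R) g).symm
  rw [h1, aeval_dual, G.one_mem R f hf]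
  simp only [h3, Algebra.smul_def, TrivSqZeroExt.inl_zero, zero_add]
  exact ⟨fun h => TrivSqZeroExt.inr_injective (h.trans (TrivSqZeroExt.inr_zero R).symm),
    fun h => by rw [h, TrivSqZeroExt.inr_zero]⟩

section Field

variable (S : Type) [Field S] [Algebra ℂ S]

/-- The `S`-span of a set of complex matrices. -/
def spanOver (A : Set (Matrix (Fin n) (Fin n) ℂ)) : Submodule S (Matrix (Fin n) (Fin n) S) :=
  Submodule.span S ((fun y => y.map (algebraMap ℂ S)) '' A)

theorem tangent_le_span {y : Matrix (Fin n) (Fin n) S} (hy : y ∈ G.tangent S) :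
    y ∈ spanOver S (G.tangent ℂ) := by
  classical
  rw [mem_tangent_iff] at hy
  let b := Module.Basis.ofVectorSpace ℂ S
  let I : Finset (Module.Basis.ofVectorSpaceIndex ℂ S) :=
    Finset.univ.biUnion fun p : Fin n × Fin n => (b.repr (y p.1 p.2)).support
  have hsum : y = ∑ k ∈ I, b k • (Matrix.of fun i j => b.repr (y i j) k).map (algebraMap ℂ S) := by
    ext i j
    rw [Matrix.sum_apply]
    have h := b.linearCombination_repr (y i j)
    rw [Finsupp.linearCombination_apply, Finsupp.sum_of_support_subset (s := I)] at h
    · rw [← h]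
      refine Finset.sum_congr rfl fun k _ => ?_
      simp [Algebra.smul_def, mul_comm]
    · exact fun k hk => Finset.mem_biUnion.2 ⟨(i, j), Finset.mem_univ _, hk⟩
    · simp
  rw [hsum]
  refine Submodule.sum_mem _ fun k _ => Submodule.smul_mem _ _ (Submodule.subset_span ⟨_, ?_, rfl⟩)
  rw [mem_tangent_iff]
  intro f hf
  have h := congrArg (fun z => b.repr z k) (hy f hf)
  simpa [Finsupp.finsetSum_apply] using h

theorem conj_tangent {R : Type} [CommRing R] [Algebra ℂ R] (X : G.points R)
    {y : Matrix (Fin n) (Fin n) R} (hy : y ∈ G.tangent R) :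
    X.1.val * y * (X.1⁻¹).val ∈ G.tangent R := by
  have hmul : ∀ A B : Matrix (Fin n) (Fin n) R,
      A.map (TrivSqZeroExt.inr : R → DualNumber R) * B.map (TrivSqZeroExt.inr : R → DualNumber R)
        = 0 := by
    intro A B
    ext i j
    all_goals simp [Matrix.mul_apply]
  have hl : ∀ A B : Matrix (Fin n) (Fin n) R,
      A.map (TrivSqZeroExt.inl : R → DualNumber R) * B.map (TrivSqZeroExt.inr : R → DualNumber R)
        = (A * B).map (TrivSqZeroExt.inr : R → DualNumber R) := by
    intro A B
    ext i j : 1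
    rw [Matrix.mul_apply, Matrix.map_apply, Matrix.mul_apply]
    refine Eq.trans ?_ (map_sum (TrivSqZeroExt.inrHom R R) _ _).symm
    exact Finset.sum_congr rfl fun k _ => TrivSqZeroExt.inl_mul_inr _ _
  have hr : ∀ A B : Matrix (Fin n) (Fin n) R,
      A.map (TrivSqZeroExt.inr : R → DualNumber R) * B.map (TrivSqZeroExt.inl : R → DualNumber R)
        = (A * B).map (TrivSqZeroExt.inr : R → DualNumber R) := by
    intro A B
    ext i j : 1
    rw [Matrix.mul_apply, Matrix.map_apply, Matrix.mul_apply]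
    refine Eq.trans ?_ (map_sum (TrivSqZeroExt.inrHom R R) _ _).symm
    exact Finset.sum_congr rfl fun k _ => TrivSqZeroExt.inr_mul_inl _ _
  let U : GL (Fin n) (DualNumber R) :=
    ⟨1 + y.map TrivSqZeroExt.inr, 1 - y.map TrivSqZeroExt.inr,
      by rw [add_mul, mul_sub, mul_sub, hmul]; simp, by rw [sub_mul, mul_add, mul_add, hmul]; simp⟩
  let X' : G.points (DualNumber R) := G.mapPoints (TrivSqZeroExt.inlAlgHom ℂ R R) X
  let V : G.points (DualNumber R) := X' * ⟨U, hy⟩ * X'⁻¹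
  have hX : X'.1.val = X.1.val.map (TrivSqZeroExt.inl : R → DualNumber R) := rfl
  have hXi : (X'.1⁻¹).val = (X.1⁻¹).val.map (TrivSqZeroExt.inl : R → DualNumber R) := by
    have h : X'⁻¹ = G.mapPoints (TrivSqZeroExt.inlAlgHom ℂ R R) X⁻¹ := (map_inv _ _).symm
    exact congrArg (fun Z : G.points (DualNumber R) => Z.1.val) h
  have hV : V.1.val = 1 + (X.1.val * y * (X.1⁻¹).val).map TrivSqZeroExt.inr := by
    change X'.1.val * (1 + y.map TrivSqZeroExt.inr) * (X'.1⁻¹).val = _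
    rw [mul_add, mul_one, add_mul, Units.mul_inv, hX, hXi, hl, hr]
  change Vanishes G.eqs _
  rw [← hV]
  exact V.2

/-- Conjugation by an invertible matrix. -/
def conj (X : GL (Fin n) S) : Matrix (Fin n) (Fin n) S →ₗ[S] Matrix (Fin n) (Fin n) S :=
  LinearMap.mulRight S (X⁻¹).val ∘ₗ LinearMap.mulLeft S X.val

theorem conj_derived (X : G.points S) :
    spanOver S (G.derivedLie : Set (Matrix (Fin n) (Fin n) ℂ))
      ≤ (spanOver S (G.derivedLie : Set (Matrix (Fin n) (Fin n) ℂ))).comap (conj S X.1) := by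
  let W := spanOver S (G.derivedLie : Set (Matrix (Fin n) (Fin n) ℂ))
  have key : ∀ u ∈ spanOver S (G.tangent ℂ), ∀ v ∈ spanOver S (G.tangent ℂ),
      u * v - v * u ∈ W := by
    intro u hu v hv
    induction hu using Submodule.span_induction with
    | mem u hu =>
      obtain ⟨u, hu, rfl⟩ := hu
      induction hv using Submodule.span_induction with
      | mem v hv =>
        obtain ⟨v, hv, rfl⟩ := hv
        refine Submodule.subset_span ⟨u * v - v * u, Submodule.subset_span ⟨u, hu, v, hv, rfl⟩, ?_⟩
        simp only [Matrix.map_sub _ (map_sub (algebraMap ℂ S)), Matrix.map_mul]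
      | zero => simp
      | add v w _ _ hv hw =>
        have := W.add_mem hv hw
        convert this using 1
        noncomm_ring
      | smul c v _ hv =>
        have := W.smul_mem c hv
        convert this using 1
        rw [mul_smul_comm, smul_mul_assoc, smul_sub]
    | zero => simp
    | add u w _ _ hu hw =>
      have := W.add_mem hu hw
      convert this using 1
      noncomm_ring
    | smul c u _ hu =>
      have := W.smul_mem c hu
      convert this using 1
      rw [mul_smul_comm, smul_mul_assoc, smul_sub]
  have htan : ∀ u ∈ G.tangent ℂ, conj S X.1 (u.map (algebraMap ℂ S)) ∈ spanOver S (G.tangent ℂ) := by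
    intro u hu
    refine G.tangent_le_span S (G.conj_tangent X ?_)
    rw [mem_tangent_iff] at hu ⊢
    intro f hf
    have h := congrArg (algebraMap ℂ S) (hu f hf)
    rw [map_sum, map_zero] at h
    rw [← h]
    refine Finset.sum_congr rfl fun p _ => ?_
    rw [Matrix.map_apply, Algebra.smul_def, smul_eq_mul, map_mul]
  refine Submodule.span_le.2 ?_
  rintro _ ⟨z, hz, rfl⟩
  change conj S X.1 (z.map (algebraMap ℂ S)) ∈ W
  induction hz using Submodule.span_induction with
  | mem z hz =>
    obtain ⟨u, hu, v, hv, rfl⟩ := hz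
    have := key _ (htan u hu) _ (htan v hv)
    convert this using 1
    rw [Matrix.map_sub _ (map_sub (algebraMap ℂ S)), Matrix.map_mul, Matrix.map_mul, map_sub]
    have hc : ∀ A B, conj S X.1 (A * B) = conj S X.1 A * conj S X.1 B := by
      intro A B
      change X.1.val * (A * B) * (X.1⁻¹).val
        = X.1.val * A * (X.1⁻¹).val * (X.1.val * B * (X.1⁻¹).val)
      have h : (X.1⁻¹).val * X.1.val = 1 := Units.inv_mul _
      calc _ = X.1.val * A * 1 * B * (X.1⁻¹).val := by simp only [mul_assoc, mul_one]
        _ = _ := by rw [← h]; simp only [mul_assoc]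
    rw [hc, hc]
  | zero => simp
  | add z w _ _ hz hw =>
    rw [Matrix.map_add _ (map_add (algebraMap ℂ S)), map_add]
    exact W.add_mem hz hw
  | smul c z _ hz =>
    have h : (c • z).map (algebraMap ℂ S) = algebraMap ℂ S c • z.map (algebraMap ℂ S) := by
      ext i j
      simp
    rw [h, map_smul]
    exact W.smul_mem _ hz

namespace Corresponds

variable {G} {𝔤 : Type*} [LieRing 𝔤] [LieAlgebra ℂ 𝔤] (c : G.Corresponds 𝔤)

/-- The embedding `S ⊗ 𝔤 → 𝔤𝔩_n(S)` induced by `𝔤 ≃ [Lie G, Lie G] ⊆ 𝔤𝔩_n(ℂ)`. -/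
def ιExt : S ⊗[ℂ] 𝔤 →ₗ[S] Matrix (Fin n) (Fin n) S :=
  ((Algebra.linearMap ℂ S).mapMatrix ∘ₗ c.ι).liftBaseChange S

theorem ιExt_tmul (s : S) (y : 𝔤) :
    c.ιExt S (s ⊗ₜ y) = s • (c.ι y).map (algebraMap ℂ S) := rfl

theorem ιExt_injective : Function.Injective (c.ιExt S) := by
  have h : ∀ y, c.ιExt S y = (matrixEquivTensor (Fin n) ℂ S).symm (c.ι.lTensor S y) := by
    intro y
    induction y using TensorProduct.induction_on with
    | zero => simp
    | add x y hx hy => rw [map_add, map_add, map_add, hx, hy]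
    | tmul s y =>
      rw [ιExt_tmul, LinearMap.lTensor_tmul, matrixEquivTensor_apply_symm]
  intro x y hxy
  rw [h, h] at hxy
  exact Module.Flat.lTensor_preserves_injective_linearMap (M := S) c.ι c.injective
    ((matrixEquivTensor (Fin n) ℂ S).symm.injective hxy)

theorem range_ιExt : LinearMap.range (c.ιExt S)
    = spanOver S (G.derivedLie : Set (Matrix (Fin n) (Fin n) ℂ)) := by
  apply le_antisymm
  · rintro _ ⟨y, rfl⟩
    induction y using TensorProduct.induction_on with
    | zero => simp
    | add x y hx hy => rw [map_add]; exact Submodule.add_mem _ hx hy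
    | tmul s y =>
      rw [ιExt_tmul]
      refine Submodule.smul_mem _ _ (Submodule.subset_span ⟨_, ?_, rfl⟩)
      rw [← c.range_eq]
      exact ⟨y, rfl⟩
  · refine Submodule.span_le.2 ?_
    rintro _ ⟨z, hz, rfl⟩
    rw [← c.range_eq] at hz
    obtain ⟨y, rfl⟩ := hz
    exact ⟨1 ⊗ₜ y, by rw [ιExt_tmul, one_smul]⟩

/-- The adjoint action `Ad_X` of `X ∈ G(S)` on `𝔤(S) = S ⊗ 𝔤`: conjugation by `X`, transported
along the embedding of `S ⊗ 𝔤` in `𝔤𝔩_n(S)`. -/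
def Ad (X : G.points S) : S ⊗[ℂ] 𝔤 →ₗ[S] S ⊗[ℂ] 𝔤 :=
  (LinearEquiv.ofInjective (c.ιExt S) (c.ιExt_injective S)).symm.toLinearMap ∘ₗ
    (conj S X.1 ∘ₗ c.ιExt S).codRestrict (LinearMap.range (c.ιExt S)) (fun y => by
      have h := G.conj_derived S X
      rw [← c.range_ιExt S] at h
      exact h ⟨y, rfl⟩)

theorem ιExt_Ad (X : G.points S) (y : S ⊗[ℂ] 𝔤) :
    c.ιExt S (c.Ad S X y) = X.1.val * c.ιExt S y * (X.1⁻¹).val := by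
  have h := LinearEquiv.apply_symm_apply
    (LinearEquiv.ofInjective (c.ιExt S) (c.ιExt_injective S))
    ((conj S X.1 ∘ₗ c.ιExt S).codRestrict (LinearMap.range (c.ιExt S)) (fun y => by
      have h := G.conj_derived S X
      rw [← c.range_ιExt S] at h
      exact h ⟨y, rfl⟩) y)
  exact congrArg Subtype.val h

/-- The adjoint action of `X ∈ G(S)` on `𝔤(S) ⊗ 𝔤(S)`. -/
def Ad₂ (X : G.points S) :
    (S ⊗[ℂ] 𝔤) ⊗[S] (S ⊗[ℂ] 𝔤) →ₗ[S] (S ⊗[ℂ] 𝔤) ⊗[S] (S ⊗[ℂ] 𝔤) :=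
  TensorProduct.map (c.Ad S X) (c.Ad S X)

end Corresponds

end Field

end LinAlgGroup

/-! ### Belavin–Drinfeld data -/

section BD

variable {𝔤 : Type*} [LieRing 𝔤] [LieAlgebra ℂ 𝔤] [FiniteDimensional ℂ 𝔤]
  [LieAlgebra.IsSimple ℂ 𝔤]

/-- An admissible triple `(Γ₁, Γ₂, τ)` for a base of the root system of `(𝔤, H)`. Only the values
of `τ` on `Γ₁` matter. -/
structure AdmissibleTriple (H : LieSubalgebra ℂ 𝔤) [H.IsCartanSubalgebra]
    (b : (LieAlgebra.IsKilling.rootSystem H).Base) where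
  Γ₁ : Finset H.root
  Γ₂ : Finset H.root
  Γ₁_subset : Γ₁ ⊆ b.support
  Γ₂_subset : Γ₂ ⊆ b.support
  τ : H.root → H.root
  bijOn : Set.BijOn τ Γ₁ Γ₂
  /-- For every `α ∈ Γ₁` some iterate `τ^k(α)` is defined and lies in `Γ₂ \ Γ₁`. -/
  nilpotent : ∀ α ∈ Γ₁, ∃ β ∈ Γ₂, β ∉ Γ₁ ∧
    Relation.ReflTransGen (fun γ γ' => γ ∈ Γ₁ ∧ τ γ = γ') α β

namespace AdmissibleTriple

variable {H : LieSubalgebra ℂ 𝔤} [H.IsCartanSubalgebra]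
  {b : (LieAlgebra.IsKilling.rootSystem H).Base} (T : AdmissibleTriple H b)

/-- `α` is a root in `Span(Γ₁)`, and `β = τ(α)`, where `τ` is extended additively from `Γ₁`
to `Span(Γ₁)`. -/
def Ext (α β : H.root) : Prop :=
  ∃ m : H.root → ℤ,
    (LieAlgebra.IsKilling.rootSystem H).root α
      = ∑ γ ∈ T.Γ₁, m γ • (LieAlgebra.IsKilling.rootSystem H).root γ ∧
    (LieAlgebra.IsKilling.rootSystem H).root β
      = ∑ γ ∈ T.Γ₁, m γ • (LieAlgebra.IsKilling.rootSystem H).root (T.τ γ)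

/-- `β = τ^k(α)` for some `k ≥ 1`, where `α, τ(α), …, τ^(k-1)(α)` are positive roots in
`Span(Γ₁)`. -/
def Prec (α β : H.root) : Prop :=
  Relation.TransGen (fun γ γ' => b.IsPos γ ∧ T.Ext γ γ') α β

end AdmissibleTriple

/-- The scalar extension `F ⊗ H → F` of a linear form on the Cartan subalgebra. -/
def formExt (F : Type*) [Field F] [Algebra ℂ F] {H : LieSubalgebra ℂ 𝔤}
    (χ : Module.Dual ℂ H) : F ⊗[ℂ] H →ₗ[F] F :=
  ((Algebra.linearMap ℂ F) ∘ₗ χ).liftBaseChange F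

variable (𝔤) in
/-- The data entering the Belavin–Drinfeld list of non-skew-symmetric `r`-matrices of a simple
complex Lie algebra `𝔤`, with the Cartan part `r₀` defined over the extension field `F` of `ℂ`. -/
structure BDData (F : Type*) [Field F] [Algebra ℂ F] where
  /-- the invariant form on `𝔤` with respect to which things are normalized -/
  B : LinearMap.BilinForm ℂ 𝔤
  B_symm : B.IsSymm
  B_nondegenerate : B.Nondegenerate
  B_invariant : B.lieInvariant 𝔤
  H : LieSubalgebra ℂ 𝔤
  [cartan : H.IsCartanSubalgebra]
  base : (LieAlgebra.IsKilling.rootSystem H).Base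
  /-- an orthonormal basis of the Cartan subalgebra -/
  t : Module.Basis (Fin (Module.finrank ℂ H)) ℂ H
  t_orthonormal : ∀ i j, B (t i) (t j) = if i = j then 1 else 0
  triple : AdmissibleTriple H base
  /-- `τ` is isometric; `(α, β) = ∑ k, α(t_k) β(t_k)` is the form induced by `B` on the dual. -/
  isometric : ∀ α ∈ triple.Γ₁, ∀ β ∈ triple.Γ₁,
    ∑ k, (triple.τ α).1 (t k) * (triple.τ β).1 (t k) = ∑ k, α.1 (t k) * β.1 (t k)
  /-- root vectors; only the values at roots matter -/
  e : LieModule.Weight ℂ H 𝔤 → 𝔤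
  e_mem : ∀ α : H.root, e α ∈ LieAlgebra.rootSpace H α.1
  e_normalized : ∀ α : H.root, B (e α) (e (-α.1)) = 1
  /-- The root vectors are compatible with `τ`: the structure constants of the `e_α` with
  `α ∈ Span(Γ₁)` are preserved by `τ`, i.e. `e_α ↦ e_{τ(α)}` extends to an isomorphism of the
  semisimple subalgebras of `𝔤` generated by the root vectors of `± Γ₁` and `± Γ₂`. -/
  e_compatible : ∀ α β γ α' β' γ' : H.root,
    triple.Ext α α' → triple.Ext β β' → triple.Ext γ γ' →
      ∀ c : ℂ, ⁅e α, e β⁆ = c • e γ → ⁅e α', e β'⁆ = c • e γ'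
  r₀ : (F ⊗[ℂ] H) ⊗[F] (F ⊗[ℂ] H)
  r₀_symm : r₀ + TensorProduct.comm F _ _ r₀
    = ∑ k, ((1 : F) ⊗ₜ[ℂ] t k) ⊗ₜ[F] ((1 : F) ⊗ₜ[ℂ] t k)
  /-- `(τ(α) ⊗ id + id ⊗ α) r₀ = 0` -/
  r₀_triple : ∀ α ∈ triple.Γ₁,
    TensorProduct.lid F _ ((formExt F ((LieAlgebra.IsKilling.rootSystem H).root
        (triple.τ α))).rTensor _ r₀)
      + TensorProduct.rid F _ ((formExt F ((LieAlgebra.IsKilling.rootSystem H).root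
        α)).lTensor _ r₀) = 0

attribute [instance] BDData.cartan

namespace BDData

variable {F : Type*} [Field F] [Algebra ℂ F] (D : BDData 𝔤 F)

/-- The tensor `x ⊗ y`, for `x, y ∈ 𝔤`, as an element of `𝔤(F) ⊗ 𝔤(F)`. -/
def tens (F : Type*) [Field F] [Algebra ℂ F] (x y : 𝔤) : (F ⊗[ℂ] 𝔤) ⊗[F] (F ⊗[ℂ] 𝔤) :=
  ((1 : F) ⊗ₜ[ℂ] x) ⊗ₜ[F] ((1 : F) ⊗ₜ[ℂ] y)

open Classical in
/-- The Belavin–Drinfeld `r`-matrix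
`r₀ + ∑_{α > 0} e_{-α} ⊗ e_α + ∑_{α ∈ Span(Γ₁)⁺} ∑_{k ≥ 1} e_{-α} ∧ e_{τ^k(α)}`,
where `x ∧ y = x ⊗ y - y ⊗ x` (by nilpotency of `τ`, the roots `τ^k(α)` with different `k`
are different). -/
def r : (F ⊗[ℂ] 𝔤) ⊗[F] (F ⊗[ℂ] 𝔤) :=
  TensorProduct.map (D.H.toSubmodule.subtype.baseChange F) (D.H.toSubmodule.subtype.baseChange F)
      D.r₀
    + ∑ α : D.H.root with D.base.IsPos α, tens F (D.e (-α.1)) (D.e α)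
    + ∑ α : D.H.root, ∑ β : D.H.root with D.triple.Prec α β,
        (tens F (D.e (-α.1)) (D.e β) - tens F (D.e β) (D.e (-α.1)))

end BDData

end BD

/-! ### Cocycles -/

/-- The automorphism `σ` of `ℂ((ħ))^alg` over `ℂ((ħ))` acting on `G` of the algebraic closure. -/
def galAct {n : ℕ} (G : LinAlgGroup n) (σ : Kbar ≃ₐ[K] Kbar) : G.points Kbar →* G.points Kbar :=
  G.mapPoints (σ.toAlgHom.restrictScalars ℂ)

section Cocycle

variable {n : ℕ} {G : LinAlgGroup n} {𝔤 : Type*} [LieRing 𝔤] [LieAlgebra ℂ 𝔤]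
  (c : G.Corresponds 𝔤)

/-- The centralizer `C(r)`: the set of `X ∈ G(ℂ((ħ))^alg)` with `Ad_X r = r`. -/
def centralizer (r : (Kbar ⊗[ℂ] 𝔤) ⊗[Kbar] (Kbar ⊗[ℂ] 𝔤)) : Set (G.points Kbar) :=
  {X | c.Ad₂ Kbar X r = r}

/-- `X` is a non-twisted Belavin–Drinfeld cocycle for `r` over the field `M` between `ℂ((ħ))` and
its algebraic closure: `X⁻¹ σ(X) ∈ C(r)` for all `σ ∈ Gal(ℂ((ħ))^alg / M)`. -/
def IsNontwistedCocycle (M : IntermediateField K Kbar)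
    (r : (Kbar ⊗[ℂ] 𝔤) ⊗[Kbar] (Kbar ⊗[ℂ] 𝔤)) (X : G.points Kbar) : Prop :=
  ∀ σ : Kbar ≃ₐ[M] Kbar, X⁻¹ * galAct G (σ.restrictScalars K) X ∈ centralizer c r

end Cocycle

end TwistedBD

end

open TwistedBD

/-!
Let `f` be the operator which the invariant form attaches to `r = r_BD`. Root vectors and the
Cartan subalgebra show that the pairs `(f z, f z - z)` make up a subalgebra of `𝔤 × 𝔤`: the
parabolic of `Γ₁` and the opposite parabolic of `Γ₂`, with Levi factors glued along `τ`. The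
bracket of this subalgebra is dual to the cobracket of `r`, so its Jacobi identity is the co-Jacobi
identity, and `s = a Ad_X r` defines a Lie bialgebra over `K̄`.

By Galois descent its cobracket is defined over `K` if and only if `τ(s) - s` is invariant for
every `τ` in the Galois group, and it suffices to take `τ = σ₀` or `τ` fixing `√ħ`. As `𝔤` is
simple, the invariant tensors are the multiples of the Casimir element `Ω = r + r²¹`, which are
symmetric. Both `u = Ad_{τ(X)} r` and `v = Ad_X r` satisfy `u + u²¹ = v + v²¹ = Ω`. If `τ(a) = a`,
then `τ(s) - s = a (u - v)` is a multiple of a skew-symmetric tensor, hence invariant only if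
`u = v`. If `τ(a) = -a`, then `τ(s) - s = -a (u + v)`, and `u + v` differs from `u - v²¹` by the
invariant `Ω`, so the condition becomes `u = v²¹`.
-/

noncomputable section

namespace TwistedBD

/-! ### Coboundary Lie bialgebras in terms of operators -/

section TensorOp

variable {R M N N' : Type*} [CommRing R] [AddCommGroup M] [Module R M] [AddCommGroup N] [Module R N]
  [AddCommGroup N'] [Module R N']

/-- The operator `x ↦ B(u, x) v` attached to the tensor `u ⊗ v` by a bilinear form `B`. -/
def tensorOp (B : LinearMap.BilinForm R M) : M ⊗[R] N →ₗ[R] M →ₗ[R] N :=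
  dualTensorHom R M N ∘ₗ LinearMap.rTensor N B

variable (B : LinearMap.BilinForm R M)

@[simp]
theorem tensorOp_tmul (u x : M) (v : N) : tensorOp B (u ⊗ₜ v) x = B u x • v := rfl

theorem tensorOp_lTensor (g : N →ₗ[R] N') (t : M ⊗[R] N) (x : M) :
    tensorOp B (g.lTensor M t) x = g (tensorOp B t x) := by
  induction t using TensorProduct.induction_on with
  | zero => simp
  | add s t hs ht => simp only [map_add, LinearMap.add_apply, hs, ht]
  | tmul u v => simp

theorem apply_tensorOp_comm (t : M ⊗[R] M) (x y : M) :
    B (tensorOp B (TensorProduct.comm R M M t) x) y = B (tensorOp B t y) x := by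
  induction t using TensorProduct.induction_on with
  | zero => simp
  | add s t hs ht => simp only [map_add, LinearMap.add_apply, hs, ht]
  | tmul u v => simp [mul_comm]

theorem tensorOp_map {M' : Type*} [AddCommGroup M'] [Module R M'] {B : LinearMap.BilinForm R M}
    {B' : LinearMap.BilinForm R M'} {θ : M →ₗ[R] M'} (hθ : ∀ x y, B' (θ x) (θ y) = B x y)
    (t : M ⊗[R] M) (x : M) :
    tensorOp B' (TensorProduct.map θ θ t) (θ x) = θ (tensorOp B t x) := by
  induction t using TensorProduct.induction_on with
  | zero => simp
  | add s t hs ht => simp only [map_add, LinearMap.add_apply, hs, ht]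
  | tmul u v => simp [hθ]

theorem apply_rid_lTensor (χ : Module.Dual R N) (t : M ⊗[R] N) (x : M) :
    B (TensorProduct.rid R M (χ.lTensor M t)) x = χ (tensorOp B t x) := by
  induction t using TensorProduct.induction_on with
  | zero => simp
  | add s t hs ht => simp only [map_add, LinearMap.add_apply, hs, ht]
  | tmul u v => simp [mul_comm]

theorem apply_lid_rTensor (χ : Module.Dual R N) (t : N ⊗[R] M) (x : M) :
    B (TensorProduct.lid R M (χ.rTensor M t)) x
      = χ (tensorOp B (TensorProduct.comm R N M t) x) := by
  induction t using TensorProduct.induction_on with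
  | zero => simp
  | add s t hs ht => simp only [map_add, LinearMap.add_apply, hs, ht]
  | tmul u v => simp [mul_comm]

theorem tensorOp_injective {k V W : Type*} [Field k] [AddCommGroup V] [Module k V]
    [FiniteDimensional k V] [AddCommGroup W] [Module k W] {B : LinearMap.BilinForm k V}
    (hB : B.SeparatingLeft) :
    Function.Injective (tensorOp B : V ⊗[k] W →ₗ[k] V →ₗ[k] W) :=
  (dualTensorHomEquiv k V W).injective.comp <|
    Module.Flat.rTensor_preserves_injective_linearMap B
      (LinearMap.ker_eq_bot.1 (LinearMap.separatingLeft_iff_ker_eq_bot.1 hB))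

end TensorOp

section LieTensorOp

variable {R L N : Type*} [CommRing R] [LieRing L] [LieAlgebra R L] [AddCommGroup N] [Module R N]
  [LieRingModule L N] [LieModule R L N] {B : LinearMap.BilinForm R L}

theorem lieInvariant_apply_lie (hB : B.lieInvariant L) (x y z : L) :
    B ⁅x, y⁆ z = B x ⁅y, z⁆ := by
  rw [← lie_skew, map_neg, LinearMap.neg_apply, hB y x z, neg_neg]

theorem tensorOp_lie (hB : B.lieInvariant L) (z : L) (t : L ⊗[R] N) (x : L) :
    tensorOp B ⁅z, t⁆ x = ⁅z, tensorOp B t x⁆ - tensorOp B t ⁅z, x⁆ := by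
  induction t using TensorProduct.induction_on with
  | zero => simp
  | add s t hs ht =>
    simp only [lie_add, map_add, LinearMap.add_apply, hs, ht]
    abel
  | tmul u v =>
    simp only [TensorProduct.LieModule.lie_tmul_right, map_add, LinearMap.add_apply,
      tensorOp_tmul, lie_smul, hB z u x]
    module

end LieTensorOp

section Coboundary

variable {k L : Type*} [Field k] [LieRing L] [LieAlgebra k L]

/-- The coboundary `x ↦ [x ⊗ 1 + 1 ⊗ x, t]` of a tensor `t`. -/
def coboundary (t : L ⊗[k] L) : L →ₗ[k] L ⊗[k] L :=
  (LieModule.toEnd k L (L ⊗[k] L) : L →ₗ[k] Module.End k (L ⊗[k] L)).flip t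

theorem coboundary_apply (t : L ⊗[k] L) (x : L) : coboundary t x = ⁅x, t⁆ := rfl

theorem coboundary_lie (t : L ⊗[k] L) (x y : L) :
    coboundary t ⁅x, y⁆ = ⁅x, coboundary t y⁆ - ⁅y, coboundary t x⁆ := by
  simp only [coboundary_apply, lie_lie]

theorem apply_tensorOp_cyc (B : LinearMap.BilinForm k L) (t : L ⊗[k] (L ⊗[k] L)) (x y z : L) :
    B (tensorOp B (tensorOp B (cyc k L t) x) y) z = B (tensorOp B (tensorOp B t z) x) y := by
  induction t using TensorProduct.induction_on with
  | zero => simp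
  | add s t hs ht => simp only [map_add, LinearMap.add_apply, hs, ht]
  | tmul u t =>
    induction t using TensorProduct.induction_on with
    | zero => simp
    | add s t hs ht => simp only [TensorProduct.tmul_add, map_add, LinearMap.add_apply, hs, ht]
    | tmul v w =>
      simp [cyc]
      ring

variable [FiniteDimensional k L] {B : LinearMap.BilinForm k L}

theorem coJacobi_of_dual (hB : B.SeparatingLeft) {δ : L →ₗ[k] L ⊗[k] L} {m : L → L → L}
    (hδ : ∀ x y z, B (tensorOp B (δ z) x) y = B z (m x y))
    (hm : ∀ x y z, m x (m y z) + m y (m z x) + m z (m x y) = 0) (w : L) :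
    δ.lTensor L (δ w) + cyc k L (δ.lTensor L (δ w))
      + cyc k L (cyc k L (δ.lTensor L (δ w))) = 0 := by
  have hδδ : ∀ x y z, B (tensorOp B (tensorOp B (δ.lTensor L (δ w)) x) y) z = B w (m x (m y z)) :=
    fun x y z => by rw [tensorOp_lTensor, hδ, hδ]
  refine tensorOp_injective hB (LinearMap.ext fun x => tensorOp_injective hB
    (LinearMap.ext fun y => ?_))
  simp only [map_zero, LinearMap.zero_apply]
  refine hB _ fun z => ?_
  simp only [map_add, LinearMap.add_apply, apply_tensorOp_cyc, hδδ]
  rw [add_right_comm, ← map_add, ← map_add, hm, map_zero]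

end Coboundary

section Cayley

variable {R L : Type*} [CommRing R] [LieRing L] [LieAlgebra R L]

/-- The map `x ↦ (f x, f x - x)`. Its range is the graph of the Cayley transform
`f x - x ↦ f x` of `f` (a relation rather than a map, as `f - 1` may have a kernel). -/
def cayley (f : L →ₗ[R] L) : L →ₗ[R] L × L := f.prod (f - LinearMap.id)

variable {f : L →ₗ[R] L}

theorem mem_range_cayley {p : L × L} :
    p ∈ LinearMap.range (cayley f) ↔ f (p.1 - p.2) = p.1 := by
  constructor
  · rintro ⟨x, rfl⟩
    simp [cayley]
  · intro h
    exact ⟨p.1 - p.2, Prod.ext h (by simp [cayley, h])⟩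

theorem cayley_injective : Function.Injective (cayley f) := fun x y h => by
  obtain ⟨h₁, h₂⟩ := Prod.ext_iff.1 h
  simpa [cayley] using congrArg₂ (· - ·) h₁ h₂

theorem range_cayley_eq_span {S : Set (L × L)} (hS : S ⊆ LinearMap.range (cayley f))
    (htop : Submodule.span R ((fun p => p.1 - p.2) '' S) = ⊤) :
    LinearMap.range (cayley f) = Submodule.span R S := by
  refine le_antisymm ?_ (Submodule.span_le.2 hS)
  rw [LinearMap.range_eq_map, ← htop, Submodule.map_span_le]
  rintro _ ⟨p, hp, rfl⟩
  have hfp := mem_range_cayley.1 (hS hp)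
  have hp' : cayley f (p.1 - p.2) = p := Prod.ext hfp (by simp [cayley, hfp])
  exact hp'.symm ▸ Submodule.subset_span hp

theorem lie_mem_range_cayley_of_span {S : Set (L × L)} (hS : S ⊆ LinearMap.range (cayley f))
    (htop : Submodule.span R ((fun p => p.1 - p.2) '' S) = ⊤)
    (hlie : ∀ p ∈ S, ∀ q ∈ S, ⁅p, q⁆ ∈ LinearMap.range (cayley f)) {p q : L × L}
    (hp : p ∈ LinearMap.range (cayley f)) (hq : q ∈ LinearMap.range (cayley f)) :
    ⁅p, q⁆ ∈ LinearMap.range (cayley f) :=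
  LinearMap.BilinMap.apply_apply_mem_of_mem_span _ S S
    (LieModule.toEnd R (L × L) (L × L) : L × L →ₗ[R] Module.End R (L × L)) hlie p q
    (range_cayley_eq_span hS htop ▸ hp) (range_cayley_eq_span hS htop ▸ hq)

/-- The bracket on `L` which `cayley f` carries to the bracket of `L × L` when its range is a
subalgebra; it is dual to the cobracket of a coboundary Lie bialgebra. -/
def dualBracket (f : L →ₗ[R] L) (x y : L) : L := ⁅f x, y⁆ + ⁅x, f y⁆ - ⁅x, y⁆

theorem dualBracket_skew (x y : L) : dualBracket f x y = -dualBracket f y x := by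
  simp only [dualBracket, ← lie_skew y, ← lie_skew (f y)]
  abel

theorem cayley_dualBracket
    (hf : ∀ p ∈ LinearMap.range (cayley f), ∀ q ∈ LinearMap.range (cayley f),
      ⁅p, q⁆ ∈ LinearMap.range (cayley f)) (x y : L) :
    cayley f (dualBracket f x y) = ⁅cayley f x, cayley f y⁆ := by
  obtain ⟨z, hz⟩ := hf _ ⟨x, rfl⟩ _ ⟨y, rfl⟩
  obtain ⟨hz₁, hz₂⟩ := Prod.ext_iff.1 hz
  have hz' : dualBracket f x y = z := by
    calc dualBracket f x y = ⁅f x, f y⁆ - ⁅f x - x, f y - y⁆ := by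
          simp only [dualBracket, sub_lie, lie_sub]
          abel
      _ = f z - (f z - z) := (congrArg₂ (· - ·) hz₁ hz₂).symm
      _ = z := sub_sub_cancel _ _
  rw [hz', hz]

theorem dualBracket_jacobi
    (hf : ∀ p ∈ LinearMap.range (cayley f), ∀ q ∈ LinearMap.range (cayley f),
      ⁅p, q⁆ ∈ LinearMap.range (cayley f)) (x y z : L) :
    dualBracket f x (dualBracket f y z) + dualBracket f y (dualBracket f z x)
      + dualBracket f z (dualBracket f x y) = 0 := by
  apply cayley_injective (f := f)
  simp only [map_add, cayley_dualBracket hf, lie_jacobi, map_zero]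

end Cayley

theorem isLieCobracket_coboundary {k L : Type*} [Field k] [LieRing L] [LieAlgebra k L]
    [FiniteDimensional k L] {B : LinearMap.BilinForm k L} (hB : B.SeparatingLeft)
    (hinv : B.lieInvariant L) {t : L ⊗[k] L}
    (hsymm : ∀ x y, B (tensorOp B t x) y + B x (tensorOp B t y) = B x y)
    (hf : ∀ p ∈ LinearMap.range (cayley (tensorOp B t)),
      ∀ q ∈ LinearMap.range (cayley (tensorOp B t)),
        ⁅p, q⁆ ∈ LinearMap.range (cayley (tensorOp B t))) :
    IsLieCobracket k L (coboundary t) := by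
  have hdual : ∀ x y z,
      B (tensorOp B (coboundary t z) x) y = B z (dualBracket (tensorOp B t) x y) := by
    intro x y z
    rw [coboundary_apply, tensorOp_lie hinv, dualBracket]
    simp only [map_add, map_sub, LinearMap.sub_apply, ← lieInvariant_apply_lie hinv]
    linear_combination -hsymm ⁅z, x⁆ y
  refine ⟨fun z => ?_, coJacobi_of_dual hB hdual (dualBracket_jacobi hf), coboundary_lie t⟩
  refine tensorOp_injective hB (LinearMap.ext fun x => sub_eq_zero.1 (hB _ fun y => ?_))
  rw [map_sub, LinearMap.sub_apply, apply_tensorOp_comm, map_neg, LinearMap.neg_apply, map_neg,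
    LinearMap.neg_apply, hdual, hdual, dualBracket_skew, map_neg, sub_self]

/-! ### Semilinear maps and change of scalars -/

section Coordinates

variable {A A' M M' ι : Type*} [CommRing A] [CommRing A'] {φ : A →+* A'} [AddCommGroup M]
  [Module A M] [AddCommGroup M'] [Module A' M'] {b : Module.Basis ι A M}
  {b' : Module.Basis ι A' M'} {f : M →ₛₗ[φ] M'}

theorem repr_apply_of_map_basis (hf : ∀ i, f (b i) = b' i) (x : M) (i : ι) :
    b'.repr (f x) i = φ (b.repr x i) := by
  have h : (b'.coord i).comp f = φ.toSemilinearMap.comp (b.coord i) :=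
    b.ext fun j => by classical simp [hf, Finsupp.single_apply, apply_ite φ]
  exact LinearMap.congr_fun h x

theorem injective_of_map_basis (hφ : Function.Injective φ) (hf : ∀ i, f (b i) = b' i) :
    Function.Injective f := fun x y hxy =>
  b.ext_elem fun i => hφ <| by rw [← repr_apply_of_map_basis hf, hxy, repr_apply_of_map_basis hf]

theorem mem_range_of_map_basis (hf : ∀ i, f (b i) = b' i) {x : M'}
    (hx : ∀ i, b'.repr x i ∈ Set.range φ) : x ∈ Set.range f := by
  rw [← b'.linearCombination_repr x]
  refine sum_mem (S := f.toAddMonoidHom.range) fun i _ => ?_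
  obtain ⟨s, hs⟩ := hx i
  exact ⟨s • b i, by simp [hf, hs]⟩

end Coordinates

section ScalarMap

variable {R A A' A'' L : Type*} [CommRing R] [CommRing A] [CommRing A'] [CommRing A'']
  [Algebra R A] [Algebra R A'] [Algebra R A''] [LieRing L] [LieAlgebra R L]

variable (L) in
/-- The semilinear map `A ⊗ L → A' ⊗ L` induced by a homomorphism `A → A'`. -/
def scal₁ (φ : A →ₐ[R] A') : A ⊗[R] L →ₛₗ[(φ : A →+* A')] A' ⊗[R] L where
  toFun := φ.toLinearMap.rTensor L
  map_add' := map_add _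
  map_smul' c x := by
    induction x using TensorProduct.induction_on with
    | zero => simp
    | add x y hx hy => simp only [smul_add, map_add, hx, hy]
    | tmul s y => simp [TensorProduct.smul_tmul']

variable (L) in
/-- The map `(A ⊗ L) ⊗ (A ⊗ L) → (A' ⊗ L) ⊗ (A' ⊗ L)` induced by a homomorphism `A → A'`. -/
def scal₂ (φ : A →ₐ[R] A') : (A ⊗[R] L) ⊗[A] (A ⊗[R] L) →ₛₗ[(φ : A →+* A')]
    (A' ⊗[R] L) ⊗[A'] (A' ⊗[R] L) :=
  TensorProduct.map (scal₁ L φ) (scal₁ L φ)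

variable (L) in
/-- The map of triple tensor products of `A ⊗ L` and of `A' ⊗ L`, bracketed to the right, induced
by a homomorphism `A → A'`. -/
def scal₃ (φ : A →ₐ[R] A') :
    (A ⊗[R] L) ⊗[A] ((A ⊗[R] L) ⊗[A] (A ⊗[R] L)) →ₛₗ[(φ : A →+* A')]
      (A' ⊗[R] L) ⊗[A'] ((A' ⊗[R] L) ⊗[A'] (A' ⊗[R] L)) :=
  TensorProduct.map (scal₁ L φ) (scal₂ L φ)

variable (φ : A →ₐ[R] A')

@[simp]
theorem scal₁_tmul (s : A) (y : L) : scal₁ L φ (s ⊗ₜ y) = φ s ⊗ₜ y := rfl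

@[simp]
theorem scal₂_tmul (x y : A ⊗[R] L) : scal₂ L φ (x ⊗ₜ y) = scal₁ L φ x ⊗ₜ scal₁ L φ y := rfl

@[simp]
theorem scal₃_tmul (x : A ⊗[R] L) (t : (A ⊗[R] L) ⊗[A] (A ⊗[R] L)) :
    scal₃ L φ (x ⊗ₜ t) = scal₁ L φ x ⊗ₜ scal₂ L φ t := rfl

theorem scal₁_lie (x y : A ⊗[R] L) : scal₁ L φ ⁅x, y⁆ = ⁅scal₁ L φ x, scal₁ L φ y⁆ := by
  induction x using TensorProduct.induction_on with
  | zero => simp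
  | add x x' hx hx' => simp only [add_lie, map_add, hx, hx']
  | tmul s u =>
    induction y using TensorProduct.induction_on with
    | zero => simp
    | add y y' hy hy' => simp only [lie_add, map_add, hy, hy']
    | tmul s' v => simp [LieAlgebra.ExtendScalars.bracket_tmul]

theorem scal₂_lie (x : A ⊗[R] L) (t : (A ⊗[R] L) ⊗[A] (A ⊗[R] L)) :
    scal₂ L φ ⁅x, t⁆ = ⁅scal₁ L φ x, scal₂ L φ t⁆ := by
  induction t using TensorProduct.induction_on with
  | zero => simp
  | add t t' h h' => simp only [lie_add, map_add, h, h']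
  | tmul u v => simp [TensorProduct.LieModule.lie_tmul_right, scal₁_lie]

theorem scal₂_comm (t : (A ⊗[R] L) ⊗[A] (A ⊗[R] L)) :
    scal₂ L φ (TensorProduct.comm A _ _ t) = TensorProduct.comm A' _ _ (scal₂ L φ t) := by
  induction t using TensorProduct.induction_on with
  | zero => simp
  | add t t' h h' => simp only [map_add, h, h']
  | tmul u v => simp

theorem scal₁_scal₁ (ψ : A' →ₐ[R] A'') (x : A ⊗[R] L) :
    scal₁ L ψ (scal₁ L φ x) = scal₁ L (ψ.comp φ) x := by
  induction x using TensorProduct.induction_on with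
  | zero => simp
  | add x x' h h' => simp only [map_add, h, h']
  | tmul s u => simp

theorem scal₂_scal₂ (ψ : A' →ₐ[R] A'') (t : (A ⊗[R] L) ⊗[A] (A ⊗[R] L)) :
    scal₂ L ψ (scal₂ L φ t) = scal₂ L (ψ.comp φ) t := by
  induction t using TensorProduct.induction_on with
  | zero => simp
  | add t t' h h' => simp only [map_add, h, h']
  | tmul u v => simp [scal₁_scal₁]

theorem linearMap_ext_scal₁ {N : Type*} [AddCommGroup N] [Module A' N] [Module R N]
    [IsScalarTower R A' N] {f g : A' ⊗[R] L →ₗ[A'] N}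
    (h : ∀ x, f (scal₁ L φ x) = g (scal₁ L φ x)) : f = g := by
  ext y
  simpa using h (1 ⊗ₜ y)

section Basis

variable {ι : Type*} (b : Module.Basis ι R L)

theorem scal₂_tensorProduct_baseChange (i : ι × ι) :
    scal₂ L φ ((b.baseChange A).tensorProduct (b.baseChange A) i)
      = (b.baseChange A').tensorProduct (b.baseChange A') i := by
  simp [Module.Basis.tensorProduct_apply']

theorem scal₃_tensorProduct_baseChange (i : ι × ι × ι) :
    scal₃ L φ ((b.baseChange A).tensorProduct
        ((b.baseChange A).tensorProduct (b.baseChange A)) i)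
      = (b.baseChange A').tensorProduct
        ((b.baseChange A').tensorProduct (b.baseChange A')) i := by
  simp [Module.Basis.tensorProduct_apply']

end Basis

variable [Module.Free R L] {φ}

theorem scal₂_injective (hφ : Function.Injective φ) : Function.Injective (scal₂ L φ) :=
  injective_of_map_basis hφ
    (scal₂_tensorProduct_baseChange φ (Module.Free.chooseBasis R L))

theorem scal₃_injective (hφ : Function.Injective φ) : Function.Injective (scal₃ L φ) :=
  injective_of_map_basis hφ
    (scal₃_tensorProduct_baseChange φ (Module.Free.chooseBasis R L))

end ScalarMap

section ScalarCobracket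

variable {R E E' L : Type*} [CommRing R] [Field E] [Field E'] [Algebra R E] [Algebra R E']
  [LieRing L] [LieAlgebra R L] (φ : E →ₐ[R] E')

theorem scal₃_cyc (t : (E ⊗[R] L) ⊗[E] ((E ⊗[R] L) ⊗[E] (E ⊗[R] L))) :
    scal₃ L φ (cyc E _ t) = cyc E' _ (scal₃ L φ t) := by
  induction t using TensorProduct.induction_on with
  | zero => simp
  | add t t' h h' => simp only [map_add, h, h']
  | tmul u t =>
    induction t using TensorProduct.induction_on with
    | zero => simp
    | add t t' h h' => simp only [TensorProduct.tmul_add, map_add, h, h']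
    | tmul v w => simp [cyc]

variable {φ} {δ : E ⊗[R] L →ₗ[E] (E ⊗[R] L) ⊗[E] (E ⊗[R] L)}
  {δ' : E' ⊗[R] L →ₗ[E'] (E' ⊗[R] L) ⊗[E'] (E' ⊗[R] L)}

theorem scal₃_lTensor (h : ∀ x, scal₂ L φ (δ x) = δ' (scal₁ L φ x))
    (t : (E ⊗[R] L) ⊗[E] (E ⊗[R] L)) :
    scal₃ L φ (δ.lTensor _ t) = δ'.lTensor _ (scal₂ L φ t) := by
  induction t using TensorProduct.induction_on with
  | zero => simp
  | add t t' h h' => simp only [map_add, h, h']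
  | tmul u v => simp [h]

theorem IsLieCobracket.of_scal₂ [Module.Free R L] (h : ∀ x, scal₂ L φ (δ x) = δ' (scal₁ L φ x))
    (h' : IsLieCobracket E' (E' ⊗[R] L) δ') : IsLieCobracket E (E ⊗[R] L) δ := by
  refine ⟨fun x => ?_, fun x => ?_, fun x y => ?_⟩
  · apply scal₂_injective φ.injective
    rw [scal₂_comm, h, h'.skew, map_neg, h]
  · apply scal₃_injective φ.injective
    simp only [map_add, map_zero, scal₃_cyc, scal₃_lTensor h, h, h'.coJacobi]
  · apply scal₂_injective φ.injective
    simp only [h, map_sub, scal₂_lie, scal₁_lie, h'.cocycle]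

theorem isLieCobracket_coboundary_scal₂ {t : (E ⊗[R] L) ⊗[E] (E ⊗[R] L)}
    (ht : IsLieCobracket E (E ⊗[R] L) (coboundary t)) :
    IsLieCobracket E' (E' ⊗[R] L) (coboundary (scal₂ L φ t)) := by
  have hδ : ∀ x, scal₂ L φ (coboundary t x) = coboundary (scal₂ L φ t) (scal₁ L φ x) :=
    fun x => scal₂_lie φ x t
  have hskew : (TensorProduct.comm E' _ _).toLinearMap ∘ₗ coboundary (scal₂ L φ t)
      = -coboundary (scal₂ L φ t) :=
    linearMap_ext_scal₁ φ fun x => by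
      simp only [LinearMap.comp_apply, LinearEquiv.coe_coe, LinearMap.neg_apply, ← hδ,
        ← scal₂_comm, ht.skew, map_neg]
  have hjacobi :
      let δδ := (coboundary (scal₂ L φ t)).lTensor _ ∘ₗ coboundary (scal₂ L φ t)
      δδ + cyc E' _ ∘ₗ δδ + cyc E' _ ∘ₗ cyc E' _ ∘ₗ δδ = 0 :=
    linearMap_ext_scal₁ φ fun x => by
      simp only [LinearMap.add_apply, LinearMap.comp_apply, ← hδ, ← scal₃_lTensor hδ,
        ← scal₃_cyc, ← map_add, ht.coJacobi, map_zero, LinearMap.zero_apply]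
  exact ⟨LinearMap.congr_fun hskew, LinearMap.congr_fun hjacobi, coboundary_lie _⟩

end ScalarCobracket

section Ext

variable {F E 𝔤 : Type*} [Field F] [Field E] [Algebra ℂ F] [Algebra ℂ E] [Algebra F E]
  [IsScalarTower ℂ F E] [LieRing 𝔤] [LieAlgebra ℂ 𝔤]

theorem ext₁_eq_scal₁ (x : F ⊗[ℂ] 𝔤) :
    ext₁ F E 𝔤 x = scal₁ 𝔤 (IsScalarTower.toAlgHom ℂ F E) x := rfl

theorem ext₂_eq_scal₂ (t : (F ⊗[ℂ] 𝔤) ⊗[F] (F ⊗[ℂ] 𝔤)) :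
    ext₂ F E 𝔤 t = scal₂ 𝔤 (IsScalarTower.toAlgHom ℂ F E) t := by
  induction t using TensorProduct.induction_on with
  | zero => simp
  | add t t' h h' => simp only [map_add, h, h']
  | tmul u v => rfl

end Ext

/-! ### Extension of scalars of invariant forms -/

section Form

variable {R L : Type*} [CommRing R] [LieRing L] [LieAlgebra R L] {B : LinearMap.BilinForm R L}

theorem lieInvariant_baseChange (A : Type*) [CommRing A] [Algebra R A]
    (hB : B.lieInvariant L) : (B.baseChange A).lieInvariant (A ⊗[R] L) := by
  intro x y z
  induction x using TensorProduct.induction_on with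
  | zero => simp
  | add x x' h h' => simp only [add_lie, map_add, LinearMap.add_apply, h, h', neg_add]
  | tmul r x =>
    induction y using TensorProduct.induction_on with
    | zero => simp
    | add y y' h h' => simp only [lie_add, map_add, LinearMap.add_apply, h, h', neg_add]
    | tmul s y =>
      induction z using TensorProduct.induction_on with
      | zero => simp
      | add z z' h h' => simp only [lie_add, map_add, h, h', neg_add]
      | tmul t z =>
        simp only [LieAlgebra.ExtendScalars.bracket_tmul, LinearMap.BilinForm.baseChange_tmul,
          hB x y z, neg_smul]
        congr 2
        ring

theorem baseChange_scal₁ {A A' : Type*} [CommRing A] [CommRing A'] [Algebra R A] [Algebra R A']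
    (φ : A →ₐ[R] A') (B : LinearMap.BilinForm R L) (x y : A ⊗[R] L) :
    B.baseChange A' (scal₁ L φ x) (scal₁ L φ y) = φ (B.baseChange A x y) := by
  induction x using TensorProduct.induction_on with
  | zero => simp
  | add x x' h h' => simp only [map_add, LinearMap.add_apply, h, h']
  | tmul s u =>
    induction y using TensorProduct.induction_on with
    | zero => simp
    | add y y' h h' => simp only [map_add, h, h']
    | tmul s' v => simp

theorem tensorOp_baseChange_scal₂ {A A' : Type*} [CommRing A] [CommRing A'] [Algebra R A]
    [Algebra R A'] (φ : A →ₐ[R] A') (B : LinearMap.BilinForm R L)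
    (t : (A ⊗[R] L) ⊗[A] (A ⊗[R] L)) (x : A ⊗[R] L) :
    tensorOp (B.baseChange A') (scal₂ L φ t) (scal₁ L φ x)
      = scal₁ L φ (tensorOp (B.baseChange A) t x) := by
  induction t using TensorProduct.induction_on with
  | zero => simp
  | add t t' h h' => simp only [map_add, LinearMap.add_apply, h, h']
  | tmul u v =>
    rw [scal₂_tmul, tensorOp_tmul, tensorOp_tmul, baseChange_scal₁, map_smulₛₗ]
    rfl

theorem separatingLeft_baseChange {k V : Type*} (E : Type*) [Field k] [AddCommGroup V] [Module k V]
    [FiniteDimensional k V] [Field E] [Algebra k E] {B : LinearMap.BilinForm k V}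
    (hB : B.SeparatingLeft) : (B.baseChange E).SeparatingLeft := by
  classical
  let b := Module.finBasis k V
  rw [← LinearMap.separatingLeft_toMatrix₂_iff b b, Matrix.separatingLeft_iff_det_ne_zero] at hB
  have hmatrix : LinearMap.toMatrix₂ (b.baseChange E) (b.baseChange E) (B.baseChange E)
      = (algebraMap k E).mapMatrix (LinearMap.toMatrix₂ b b B) := by
    ext i j
    simp [LinearMap.toMatrix₂_apply, Algebra.smul_def]
  rw [← LinearMap.separatingLeft_toMatrix₂_iff (b.baseChange E) (b.baseChange E),
    Matrix.separatingLeft_iff_det_ne_zero, hmatrix, ← RingHom.map_det]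
  exact (map_ne_zero _).2 hB

end Form

/-! ### Invariant forms and tensors of a simple Lie algebra -/

section DualContract

variable {k V W : Type*} [Field k] [AddCommGroup V] [Module k V] [AddCommGroup W] [Module k W]

variable (W) in
/-- The contraction `v ⊗ w ↦ ξ(v) w` of the left factor of a tensor with a functional `ξ`. -/
def dualContract (ξ : Module.Dual k V) : V ⊗[k] W →ₗ[k] W :=
  (TensorProduct.lid k W).toLinearMap ∘ₗ ξ.rTensor W

@[simp]
theorem dualContract_tmul (ξ : Module.Dual k V) (v : V) (w : W) :
    dualContract W ξ (v ⊗ₜ w) = ξ v • w := rfl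

theorem eq_of_forall_dualContract_eq {x y : V ⊗[k] W}
    (h : ∀ ξ : Module.Dual k V, dualContract W ξ x = dualContract W ξ y) : x = y := by
  classical
  let b := Module.Basis.ofVectorSpace k V
  refine (TensorProduct.equivFinsuppOfBasisLeft b).injective (Finsupp.ext fun i => ?_)
  rw [TensorProduct.equivFinsuppOfBasisLeft_apply, TensorProduct.equivFinsuppOfBasisLeft_apply]
  exact h _

theorem apply_dualContract (ξ : Module.Dual k V) (η : Module.Dual k W) (x : V ⊗[k] W) :
    η (dualContract W ξ x) = ξ (TensorProduct.rid k V (η.lTensor V x)) := by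
  induction x using TensorProduct.induction_on with
  | zero => simp
  | add x y hx hy => simp only [map_add, hx, hy]
  | tmul v w => simp [mul_comm]

theorem dualContract_lie {L E : Type*} [LieRing L] [LieAlgebra k L] [CommRing E] [Algebra k E]
    (ξ : Module.Dual k E) (x : L) (y : E ⊗[k] L) :
    dualContract L ξ ⁅(1 : E) ⊗ₜ[k] x, y⁆ = ⁅x, dualContract L ξ y⁆ := by
  induction y using TensorProduct.induction_on with
  | zero => simp
  | add y z hy hz => simp only [map_add, lie_add, hy, hz]
  | tmul s y => simp [LieAlgebra.ExtendScalars.bracket_tmul]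

end DualContract

section Schur

variable {k L : Type*} [Field k] [LieRing L] [LieAlgebra k L] [LieAlgebra.IsSimple k L]

variable (k L) in
include k in
theorem nontrivial_of_isSimple : Nontrivial L := by
  by_contra hL
  have := not_nontrivial_iff_subsingleton.1 hL
  exact LieAlgebra.IsSimple.non_abelian k (L := L) ⟨fun _ _ => Subsingleton.elim _ _⟩

variable [IsAlgClosed k] [FiniteDimensional k L]

theorem exists_eq_smul_id_of_commute {φ : L →ₗ[k] L} (hφ : ∀ x y : L, φ ⁅x, y⁆ = ⁅x, φ y⁆) :
    ∃ c : k, φ = c • LinearMap.id := by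
  have := nontrivial_of_isSimple k L
  obtain ⟨c, hc⟩ := Module.End.exists_eigenvalue φ
  let I : LieIdeal k L :=
    { Module.End.eigenspace φ c with
      lie_mem := fun {x y} hy => Module.End.mem_eigenspace_iff.2 <| by
        rw [hφ, Module.End.mem_eigenspace_iff.1 hy, lie_smul] }
  have hI : I = ⊤ := (LieAlgebra.IsSimple.eq_bot_or_eq_top (R := k) I).resolve_left fun h =>
    hc ((LieSubmodule.toSubmodule_eq_bot I).2 h)
  exact ⟨c, LinearMap.ext fun x => Module.End.mem_eigenspace_iff.1 (show x ∈ I from hI ▸ trivial)⟩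

/- Contracting with a functional on `E` reduces to the case `E = k`; the scalar is then found on a
single vector of `L`. -/
theorem exists_eq_smul_id_of_commute_baseChange {E : Type*} [Field E] [Algebra k E]
    {f : E ⊗[k] L →ₗ[E] E ⊗[k] L}
    (hf : ∀ (x : L) (y : E ⊗[k] L), f ⁅(1 : E) ⊗ₜ[k] x, y⁆ = ⁅(1 : E) ⊗ₜ[k] x, f y⁆) :
    ∃ c : E, f = c • LinearMap.id := by
  have hscalar : ∀ ξ, ∃ c : k, ∀ y : L, dualContract L ξ (f (1 ⊗ₜ y)) = c • y := by
    intro ξ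
    obtain ⟨c, hc⟩ := exists_eq_smul_id_of_commute
      (φ := dualContract L ξ ∘ₗ f.restrictScalars k ∘ₗ TensorProduct.mk k E L 1) fun x y => by
        simp only [LinearMap.comp_apply, TensorProduct.mk_apply, LinearMap.restrictScalars_apply]
        rw [← dualContract_lie, ← hf, LieAlgebra.ExtendScalars.bracket_tmul, one_mul]
    exact ⟨c, LinearMap.congr_fun hc⟩
  have := nontrivial_of_isSimple k L
  obtain ⟨y₀, hy₀⟩ := exists_ne (0 : L)
  obtain ⟨η, hη⟩ := Module.Projective.exists_dual_eq_one k hy₀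
  refine ⟨TensorProduct.rid k E (η.lTensor E (f (1 ⊗ₜ y₀))), ?_⟩
  ext y
  refine eq_of_forall_dualContract_eq fun ξ => ?_
  obtain ⟨c, hc⟩ := hscalar ξ
  have hcξ : ξ (TensorProduct.rid k E (η.lTensor E (f (1 ⊗ₜ y₀)))) = c := by
    rw [← apply_dualContract, hc, map_smul, hη, smul_eq_mul, mul_one]
  simp [hc, hcξ, TensorProduct.smul_tmul']

theorem exists_eq_smul_of_invariant {E : Type*} [Field E] [Algebra k E]
    {B : LinearMap.BilinForm k L} (hsep : B.SeparatingLeft) (hB : B.lieInvariant L)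
    {Ω t : (E ⊗[k] L) ⊗[E] (E ⊗[k] L)} (hΩ : tensorOp (B.baseChange E) Ω = LinearMap.id)
    (ht : ∀ x : L, ⁅(1 : E) ⊗ₜ[k] x, t⁆ = 0) : ∃ c : E, t = c • Ω := by
  obtain ⟨c, hc⟩ := exists_eq_smul_id_of_commute_baseChange (f := tensorOp (B.baseChange E) t)
    fun x y => (sub_eq_zero.1 <| by
      rw [← tensorOp_lie (lieInvariant_baseChange E hB), ht, map_zero, LinearMap.zero_apply]).symm
  exact ⟨c, tensorOp_injective (separatingLeft_baseChange E hsep) (by rw [hc, map_smul, hΩ])⟩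

end Schur

section Killing

variable {k L : Type*} [Field k] [IsAlgClosed k] [CharZero k] [LieRing L] [LieAlgebra k L]
  [FiniteDimensional k L] [LieAlgebra.IsSimple k L] {B : LinearMap.BilinForm k L}

theorem exists_eq_smul_killingForm (hB : B.lieInvariant L) : ∃ c : k, B = c • killingForm k L := by
  have hκ := LieAlgebra.IsKilling.killingForm_nondegenerate k L
  let φ : L →ₗ[k] L := (LinearMap.BilinForm.toDual (killingForm k L) hκ).symm.toLinearMap ∘ₗ B
  have hφ : ∀ x y, killingForm k L (φ x) y = B x y := fun x y =>
    LinearMap.BilinForm.apply_toDual_symm_apply (hB := hκ) (B x) y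
  obtain ⟨c, hc⟩ := exists_eq_smul_id_of_commute (φ := φ) fun x y => by
    refine sub_eq_zero.1 (hκ.1 _ fun z => ?_)
    rw [map_sub, LinearMap.sub_apply, hφ, hB x y z,
      LieModule.traceForm_lieInvariant k L L x (φ y) z]
    exact (sub_neg_eq_add _ _).trans (by rw [← hφ]; exact neg_add_cancel _)
  refine ⟨c, LinearMap.ext₂ fun x y => ?_⟩
  rw [← hφ, hc]
  simp

theorem baseChange_apply_lieEquiv {E : Type*} [Field E] [Algebra k E] (hB : B.lieInvariant L)
    (θ : (E ⊗[k] L) ≃ₗ⁅E⁆ (E ⊗[k] L)) (x y : E ⊗[k] L) :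
    B.baseChange E (θ x) (θ y) = B.baseChange E x y := by
  obtain ⟨c, rfl⟩ := exists_eq_smul_killingForm hB
  have hκ : (c • killingForm k L).baseChange E
      = algebraMap k E c • killingForm E (E ⊗[k] L) := by
    rw [show killingForm E (E ⊗[k] L) = (killingForm k L).baseChange E from
      LieModule.traceForm_baseChange (R := k) (L := L) (M := L) E]
    ext u v
    simp [Algebra.smul_def]
  simp only [hκ, LinearMap.smul_apply, LieAlgebra.killingForm_of_equiv_apply]

end Killing

/-! ### Root systems and the extension of a map of simple roots -/

section Roots

variable {ι R M N : Type*} [Field R] [AddCommGroup M] [Module R M] [AddCommGroup N] [Module R N]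
  {P : RootPairing ι R M N}

section Coefficients

variable [CharZero R] (b : P.Base)

/-- The coefficient of the simple root `j` in the expansion of the root `i`; it is `0` if `j` is
not simple. -/
def coeff (i j : ι) : ℤ := (b.exists_root_eq_sum_int i).choose j

theorem root_eq_sum_coeff (i : ι) : P.root i = ∑ j ∈ b.support, coeff b i j • P.root j :=
  (b.exists_root_eq_sum_int i).choose_spec.2.2

theorem coeff_of_notMem (i : ι) {j : ι} (hj : j ∉ b.support) : coeff b i j = 0 := by
  by_contra h
  exact hj ((b.exists_root_eq_sum_int i).choose_spec.1 h)

theorem coeff_eq_indicator {Γ : Finset ι} (hΓ : Γ ⊆ b.support) {i : ι} {m : ι → ℤ}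
    (hm : P.root i = ∑ l ∈ Γ, m l • P.root l) : coeff b i = (Γ : Set ι).indicator m := by
  have hsupp : P.root i = ∑ l ∈ b.support, (Γ : Set ι).indicator m l • P.root l := by
    refine hm.trans ((Finset.sum_congr rfl fun l hl => ?_).trans
      (Finset.sum_subset hΓ fun l _ hl => ?_))
    · rw [Set.indicator_of_mem (Finset.mem_coe.2 hl)]
    · rw [Set.indicator_of_notMem (mt Finset.mem_coe.1 hl), zero_smul]
  funext j
  by_cases hj : j ∈ b.support
  · exact linearIndepOn_finset_iffₛ.1 (b.linearIndepOn_root.restrict_scalars' ℤ) _ _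
      ((root_eq_sum_coeff b i).symm.trans hsupp) j hj
  · rw [coeff_of_notMem b i hj, Set.indicator_of_notMem fun h => hj (hΓ (Finset.mem_coe.1 h))]

theorem coeff_add_zsmul {i j k : ι} {z : ℤ} (h : P.root k = P.root i + z • P.root j) (l : ι) :
    coeff b k l = coeff b i l + z * coeff b j l := by
  rw [coeff_eq_indicator b subset_rfl (m := fun l => coeff b i l + z * coeff b j l)]
  · by_cases hl : l ∈ b.support
    · rw [Set.indicator_of_mem (Finset.mem_coe.2 hl)]
    · rw [Set.indicator_of_notMem (mt Finset.mem_coe.1 hl), coeff_of_notMem b i hl,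
        coeff_of_notMem b j hl, mul_zero, add_zero]
  · simp only [add_smul, mul_smul, Finset.sum_add_distrib, ← Finset.smul_sum,
      ← root_eq_sum_coeff, h]

theorem coeff_neg {i j : ι} (h : P.root j = -P.root i) (l : ι) :
    coeff b j l = -coeff b i l := by
  rw [coeff_add_zsmul b (i := i) (j := i) (z := -2) (by rw [h]; module)]
  ring

theorem coeff_injective : Function.Injective (coeff b) := fun i j h =>
  P.root.injective (by rw [root_eq_sum_coeff b i, root_eq_sum_coeff b j, h])

theorem height_eq_sum_coeff (i : ι) : b.height i = ∑ j ∈ b.support, coeff b i j :=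
  RootPairing.Base.height_eq_sum (root_eq_sum_coeff b i)

theorem exists_coeff_ne_zero (i : ι) : ∃ j, coeff b i j ≠ 0 := by
  by_contra! h
  exact b.height_ne_zero i (by rw [height_eq_sum_coeff, Finset.sum_eq_zero fun j _ => h j])

theorem coeff_nonneg {i : ι} (h : b.IsPos i) (j : ι) : 0 ≤ coeff b i j := by
  have hsign : 0 < coeff b i ∨ coeff b i < 0 := (b.exists_root_eq_sum_int i).choose_spec.2.1
  refine (hsign.resolve_right fun hneg => ?_).le j
  rw [RootPairing.Base.isPos_iff, height_eq_sum_coeff] at h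
  exact absurd h (not_lt.2 (Finset.sum_nonpos fun j _ => hneg.le j))

theorem isPos_neg_iff {i j : ι} (h : P.root j = -P.root i) : b.IsPos j ↔ ¬b.IsPos i := by
  have hheight : b.height j = -b.height i := by
    simp only [height_eq_sum_coeff, coeff_neg b h, Finset.sum_neg_distrib]
  have := b.height_ne_zero i
  rw [RootPairing.Base.isPos_iff, RootPairing.Base.isPos_iff, hheight]
  lia

open Classical in
/-- The height of a root with respect to the simple roots outside `Γ`. It vanishes exactly on the
roots in the span of `Γ`, and its sign is that of the root elsewhere. -/
def heightOff (Γ : Finset ι) (i : ι) : ℤ := ∑ j ∈ b.support \ Γ, coeff b i j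

variable {Γ : Finset ι}

theorem heightOff_add_zsmul {i j k : ι} {z : ℤ} (h : P.root k = P.root i + z • P.root j) :
    heightOff b Γ k = heightOff b Γ i + z * heightOff b Γ j := by
  simp only [heightOff, coeff_add_zsmul b h, Finset.sum_add_distrib, Finset.mul_sum]

theorem heightOff_add {i j k : ι} (h : P.root k = P.root i + P.root j) :
    heightOff b Γ k = heightOff b Γ i + heightOff b Γ j := by
  simpa using heightOff_add_zsmul b (i := i) (j := j) (z := 1) (by rw [one_smul, h])

theorem heightOff_neg {i j : ι} (h : P.root j = -P.root i) :
    heightOff b Γ j = -heightOff b Γ i := by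
  simp only [heightOff, coeff_neg b h, Finset.sum_neg_distrib]

theorem isPos_of_heightOff_pos {i : ι} (h : 0 < heightOff b Γ i) : b.IsPos i := by
  by_contra hi
  let := P.indexNeg
  have hneg : P.root (-i) = -P.root i := by simp
  have hnonneg : 0 ≤ heightOff b Γ (-i) :=
    Finset.sum_nonneg fun j _ => coeff_nonneg b ((isPos_neg_iff b hneg).2 hi) j
  rw [heightOff_neg b hneg] at hnonneg
  lia

theorem not_isPos_of_heightOff_neg {i : ι} (h : heightOff b Γ i < 0) : ¬b.IsPos i := fun hi =>
  absurd (Finset.sum_nonneg fun j _ => coeff_nonneg b hi j) (not_le.2 h)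

theorem heightOff_eq_zero_iff {i : ι} : heightOff b Γ i = 0 ↔ ∀ j ∉ Γ, coeff b i j = 0 := by
  classical
  have key : ∀ i, b.IsPos i → (heightOff b Γ i = 0 ↔ ∀ j ∉ Γ, coeff b i j = 0) := by
    intro i hi
    rw [heightOff, Finset.sum_eq_zero_iff_of_nonneg fun j _ => coeff_nonneg b hi j]
    refine ⟨fun h j hj => ?_, fun h j hj => h j (Finset.mem_sdiff.1 hj).2⟩
    by_cases hs : j ∈ b.support
    · exact h j (Finset.mem_sdiff.2 ⟨hs, hj⟩)
    · exact coeff_of_notMem b i hs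
  by_cases hi : b.IsPos i
  · exact key i hi
  · let := P.indexNeg
    have hneg : P.root (-i) = -P.root i := by simp
    simpa only [heightOff_neg b hneg, coeff_neg b hneg, neg_eq_zero]
      using key (-i) ((isPos_neg_iff b hneg).2 hi)

theorem heightOff_eq_zero_of_root_eq_sum (hΓ : Γ ⊆ b.support) {i : ι} {m : ι → ℤ}
    (hm : P.root i = ∑ l ∈ Γ, m l • P.root l) : heightOff b Γ i = 0 :=
  (heightOff_eq_zero_iff b).2 fun j hj => by
    rw [coeff_eq_indicator b hΓ hm, Set.indicator_of_notMem (mt Finset.mem_coe.1 hj)]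

theorem heightOff_of_mem {i : ι} (hi : i ∈ b.support) (hiΓ : i ∈ Γ) : heightOff b Γ i = 0 :=
  (heightOff_eq_zero_iff b).2 fun j hj => by
    rw [coeff_eq_indicator b (Finset.singleton_subset_iff.2 hi) (m := 1) (by simp)]
    exact Set.indicator_of_notMem (by grind) _

theorem root_eq_sum_of_heightOff_eq_zero (hΓ : Γ ⊆ b.support) {i : ι}
    (hi : heightOff b Γ i = 0) : P.root i = ∑ l ∈ Γ, coeff b i l • P.root l := by
  rw [root_eq_sum_coeff b i]
  refine (Finset.sum_subset hΓ fun l _ hl => ?_).symm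
  rw [(heightOff_eq_zero_iff b).1 hi l hl, zero_smul]

theorem mem_of_pairingIn_pos [Finite ι] [P.IsCrystallographic] {i j : ι} (hpos : b.IsPos i)
    (hi : heightOff b Γ i = 0) (hj : j ∈ b.support) (hij : 0 < P.pairingIn ℤ i j) : j ∈ Γ := by
  by_contra hjΓ
  have hexpand : P.pairingIn ℤ i j = ∑ l ∈ b.support, coeff b i l * P.pairingIn ℤ l j := by
    apply (algebraMap ℤ R).injective_int
    simp_rw [map_sum, map_mul, P.algebraMap_pairingIn, ← P.root_coroot_eq_pairing]
    rw [root_eq_sum_coeff b i]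
    simp
  refine absurd hij (not_lt.2 (hexpand.trans_le (Finset.sum_nonpos fun l hl => ?_)))
  by_cases hlj : l = j
  · rw [hlj, (heightOff_eq_zero_iff b).1 hi j hjΓ, zero_mul]
  · exact mul_nonpos_of_nonneg_of_nonpos (coeff_nonneg b hpos l)
      (b.pairingIn_le_zero_of_ne hlj hl hj)

end Coefficients

variable {Γ₁ Γ₂ : Finset ι} {τ : ι → ι}

variable (P) in
/-- `SpanMap P Γ τ i j`: the root `i` is in the span of `Γ`, and the additive extension of
`τ : Γ → ι` to this span maps it to the root `j`. The coefficients of `i` are existentially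
quantified, so that the notion makes sense without a base. -/
def SpanMap (Γ : Finset ι) (τ : ι → ι) (i j : ι) : Prop :=
  ∃ m : ι → ℤ, P.root i = ∑ l ∈ Γ, m l • P.root l ∧ P.root j = ∑ l ∈ Γ, m l • P.root (τ l)

theorem SpanMap.of_mem {i : ι} (hi : i ∈ Γ₁) : SpanMap P Γ₁ τ i (τ i) := by
  classical
  refine ⟨Pi.single i 1, ?_, ?_⟩ <;>
  · rw [Finset.sum_eq_single_of_mem i hi fun l _ hl => by simp [hl]]
    simp

theorem SpanMap.neg {i j i' j' : ι} (h : SpanMap P Γ₁ τ i j) (hi : P.root i' = -P.root i)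
    (hj : P.root j' = -P.root j) : SpanMap P Γ₁ τ i' j' := by
  obtain ⟨m, hmi, hmj⟩ := h
  exact ⟨-m, by simp [hi, hmi], by simp [hj, hmj]⟩

theorem SpanMap.add_zsmul {i i' j j' k k' : ι} {z : ℤ} (hi : SpanMap P Γ₁ τ i i')
    (hj : SpanMap P Γ₁ τ j j') (hk : P.root k = P.root i + z • P.root j)
    (hk' : P.root k' = P.root i' + z • P.root j') : SpanMap P Γ₁ τ k k' := by
  obtain ⟨m, hmi, hmi'⟩ := hi
  obtain ⟨n, hnj, hnj'⟩ := hj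
  refine ⟨m + z • n, ?_, ?_⟩
  · simp [hk, hmi, hnj, add_smul, mul_smul, Finset.sum_add_distrib, Finset.smul_sum]
  · simp [hk', hmi', hnj', add_smul, mul_smul, Finset.sum_add_distrib, Finset.smul_sum]

section Isometry

variable [CharZero R] [P.IsCrystallographic]
  (hP : ∀ i ∈ Γ₁, ∀ j ∈ Γ₁, P.pairing (τ i) (τ j) = P.pairing i j)
include hP

theorem SpanMap.pairingIn_eq {i i' j : ι} (h : SpanMap P Γ₁ τ i i') (hj : j ∈ Γ₁) :
    P.pairingIn ℤ i' (τ j) = P.pairingIn ℤ i j := by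
  obtain ⟨m, hm, hm'⟩ := h
  apply (algebraMap ℤ R).injective_int
  rw [P.algebraMap_pairingIn, P.algebraMap_pairingIn, ← P.root_coroot_eq_pairing,
    ← P.root_coroot_eq_pairing, hm, hm']
  simp only [map_sum, map_zsmul, LinearMap.sum_apply, LinearMap.smul_apply,
    P.root_coroot_eq_pairing]
  exact Finset.sum_congr rfl fun l hl => by rw [hP l hl j hj]

theorem SpanMap.reflectionPerm {i i' j : ι} (h : SpanMap P Γ₁ τ i i') (hj : j ∈ Γ₁) :
    SpanMap P Γ₁ τ (P.reflectionPerm j i) (P.reflectionPerm (τ j) i') :=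
  h.add_zsmul (SpanMap.of_mem hj) (z := -P.pairingIn ℤ i j)
    (by rw [P.root_reflectionPerm, P.reflection_apply_root' ℤ, neg_smul, sub_eq_add_neg])
    (by rw [P.root_reflectionPerm, P.reflection_apply_root' ℤ, h.pairingIn_eq hP hj, neg_smul,
      sub_eq_add_neg])

variable [Finite ι] [P.IsReduced] {b : P.Base}

theorem exists_spanMap_of_isPos {i : ι} (hpos : b.IsPos i) (hi : heightOff b Γ₁ i = 0) :
    ∃ j, SpanMap P Γ₁ τ i j := by
  induction hn : (b.height i).toNat using Nat.strongRecOn generalizing i with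
  | ind n ih =>
    obtain ⟨j, hj, hij⟩ := hpos.exists_mem_support_pos_pairingIn
    rw [P.zero_lt_pairingIn_iff'] at hij
    have hjΓ : j ∈ Γ₁ := mem_of_pairingIn_pos b hpos hi hj hij
    by_cases hne : i = j
    · exact ⟨τ i, SpanMap.of_mem (hne ▸ hjΓ)⟩
    have hroot : P.root (P.reflectionPerm j i) = P.root i + (-P.pairingIn ℤ i j) • P.root j := by
      rw [P.root_reflectionPerm, neg_smul, P.reflection_apply_root' ℤ, sub_eq_add_neg]
    have hkpos : b.IsPos (P.reflectionPerm j i) := hpos.reflectionPerm hj hne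
    have hk : heightOff b Γ₁ (P.reflectionPerm j i) = 0 := by
      rw [heightOff_add_zsmul b hroot, hi, heightOff_of_mem b hj hjΓ, mul_zero, add_zero]
    have hheight : b.height (P.reflectionPerm j i) < b.height i := by
      rw [b.height_add_zsmul hroot, RootPairing.Base.height_one_of_mem_support hj, smul_eq_mul,
        mul_one]
      lia
    obtain ⟨k', hk'⟩ := ih _
      (by have := (RootPairing.Base.isPos_iff b).1 hkpos; lia) hkpos hk rfl
    exact ⟨_, P.reflectionPerm_self j i ▸ hk'.reflectionPerm hP hjΓ⟩

theorem exists_spanMap {i : ι} (hi : heightOff b Γ₁ i = 0) : ∃ j, SpanMap P Γ₁ τ i j := by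
  by_cases hpos : b.IsPos i
  · exact exists_spanMap_of_isPos hP hpos hi
  · let := P.indexNeg
    have hneg : P.root (-i) = -P.root i := by simp
    obtain ⟨j, hj⟩ := exists_spanMap_of_isPos hP ((isPos_neg_iff b hneg).2 hpos)
      (by rw [heightOff_neg b hneg, hi, neg_zero])
    exact ⟨-j, hj.neg (by simp) (by simp)⟩

end Isometry

section Bijection

variable [CharZero R] {b : P.Base} (h₁ : Γ₁ ⊆ b.support) (h₂ : Γ₂ ⊆ b.support)
  (hτ : Set.BijOn τ Γ₁ Γ₂)
include h₁ h₂ hτ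

theorem spanMap_iff {i j : ι} : SpanMap P Γ₁ τ i j ↔
    heightOff b Γ₁ i = 0 ∧ heightOff b Γ₂ j = 0 ∧ ∀ l ∈ Γ₁, coeff b j (τ l) = coeff b i l := by
  have hreindex (m : ι → ℤ) :
      ∑ l ∈ Γ₂, m l • P.root l = ∑ l ∈ Γ₁, m (τ l) • P.root (τ l) :=
    (Finset.sum_nbij τ (fun l hl => hτ.mapsTo hl) hτ.injOn hτ.surjOn fun l _ => rfl).symm
  constructor
  · rintro ⟨m, hi, hj⟩
    have : Nonempty ι := ⟨i⟩
    have hinv : ∀ l ∈ Γ₁, Function.invFunOn τ Γ₁ (τ l) = l := fun l hl =>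
      hτ.injOn.leftInvOn_invFunOn hl
    have hj' : P.root j = ∑ l ∈ Γ₂, m (Function.invFunOn τ Γ₁ l) • P.root l := by
      rw [hreindex fun l => m (Function.invFunOn τ Γ₁ l), hj]
      exact Finset.sum_congr rfl fun l hl => by rw [hinv l hl]
    refine ⟨heightOff_eq_zero_of_root_eq_sum b h₁ hi, heightOff_eq_zero_of_root_eq_sum b h₂ hj',
      fun l hl => ?_⟩
    rw [coeff_eq_indicator b h₁ hi, coeff_eq_indicator b h₂ hj', Set.indicator_of_mem hl,
      Set.indicator_of_mem (hτ.mapsTo hl), hinv l hl]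
  · rintro ⟨hi, hj, h⟩
    refine ⟨coeff b i, root_eq_sum_of_heightOff_eq_zero b h₁ hi, ?_⟩
    rw [root_eq_sum_of_heightOff_eq_zero b h₂ hj, hreindex]
    exact Finset.sum_congr rfl fun l hl => by rw [h l hl]

theorem SpanMap.right_unique {i j j' : ι} (h : SpanMap P Γ₁ τ i j) (h' : SpanMap P Γ₁ τ i j') :
    j = j' := by
  rw [spanMap_iff h₁ h₂ hτ, heightOff_eq_zero_iff, heightOff_eq_zero_iff] at h h'
  refine coeff_injective b (funext fun l => ?_)
  by_cases hl : l ∈ Γ₂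
  · obtain ⟨l, hl', rfl⟩ := hτ.surjOn hl
    rw [h.2.2 l hl', h'.2.2 l hl']
  · rw [h.2.1 l hl, h'.2.1 l hl]

theorem SpanMap.left_unique {i i' j : ι} (h : SpanMap P Γ₁ τ i j) (h' : SpanMap P Γ₁ τ i' j) :
    i = i' := by
  rw [spanMap_iff h₁ h₂ hτ, heightOff_eq_zero_iff, heightOff_eq_zero_iff] at h h'
  refine coeff_injective b (funext fun l => ?_)
  by_cases hl : l ∈ Γ₁
  · rw [← h.2.2 l hl, ← h'.2.2 l hl]
  · rw [h.1 l hl, h'.1 l hl]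

theorem SpanMap.isPos {i j : ι} (h : SpanMap P Γ₁ τ i j) (hi : b.IsPos i) : b.IsPos j := by
  rw [spanMap_iff h₁ h₂ hτ, heightOff_eq_zero_iff, heightOff_eq_zero_iff] at h
  rw [RootPairing.Base.isPos_iff', height_eq_sum_coeff]
  refine Finset.sum_nonneg fun l _ => ?_
  by_cases hl : l ∈ Γ₂
  · obtain ⟨l, hl', rfl⟩ := hτ.surjOn hl
    rw [h.2.2 l hl']
    exact coeff_nonneg b hi l
  · rw [h.2.1 l hl]

theorem exists_spanMap_left [Finite ι] [P.IsCrystallographic] [P.IsReduced]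
    (hP : ∀ i ∈ Γ₁, ∀ j ∈ Γ₁, P.pairing (τ i) (τ j) = P.pairing i j) {j : ι}
    (hj : heightOff b Γ₂ j = 0) : ∃ i, SpanMap P Γ₁ τ i j := by
  have : Nonempty ι := ⟨j⟩
  have hinv := hτ.invOn_invFunOn
  have hτ' : Set.BijOn (Function.invFunOn τ Γ₁) Γ₂ Γ₁ := hτ.symm hinv.symm
  obtain ⟨i, hi⟩ := exists_spanMap (fun k hk l hl => by
    rw [← hP _ (hτ'.mapsTo hk) _ (hτ'.mapsTo hl), hinv.2 hk, hinv.2 hl]) hj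
  rw [spanMap_iff h₂ h₁ hτ'] at hi
  refine ⟨i, (spanMap_iff h₁ h₂ hτ).2 ⟨hi.2.1, hi.1, fun l hl => ?_⟩⟩
  rw [← hi.2.2 _ (hτ.mapsTo hl), hinv.1 hl]

/- A root `i` with a nonzero coefficient at `l` is moved by the extended `τ` to a root with a
nonzero coefficient at `τ l`, so each simple root in the support of `i` bounds the length of the
orbit. -/
theorem wellFounded_spanMap (hnil : ∀ i ∈ Γ₁, ∃ j, j ∉ Γ₁ ∧
      Relation.ReflTransGen (fun k l => k ∈ Γ₁ ∧ τ k = l) i j) :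
    WellFounded fun j i => SpanMap P Γ₁ τ i j := by
  have hsimple (i : ι) : Acc (fun l k => k ∈ Γ₁ ∧ τ k = l) i := by
    by_cases hi : i ∈ Γ₁
    · obtain ⟨j, hj, hij⟩ := hnil i hi
      induction hij using Relation.ReflTransGen.head_induction_on with
      | refl => exact absurd hi hj
      | @head k l hkl _ ih =>
        refine Acc.intro _ fun y hy => ?_
        obtain rfl : l = y := hkl.2.symm.trans hy.2
        by_cases hl : l ∈ Γ₁
        · exact ih hl
        · exact Acc.intro _ fun y hy => absurd hy.1 hl
    · exact Acc.intro _ fun y hy => absurd hy.1 hi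
  have hroot (l : ι) : ∀ i, coeff b i l ≠ 0 → Acc (fun j i => SpanMap P Γ₁ τ i j) i := by
    induction hsimple l with
    | intro l _ ih =>
      intro i hi
      refine Acc.intro _ fun j hj => ?_
      rw [spanMap_iff h₁ h₂ hτ, heightOff_eq_zero_iff] at hj
      have hl : l ∈ Γ₁ := by
        by_contra hl
        exact hi (hj.1 l hl)
      exact ih (τ l) ⟨hl, rfl⟩ j (by rwa [hj.2.2 l hl])
  exact ⟨fun i => (exists_coeff_ne_zero b i).elim fun l hl => hroot l i hl⟩

end Bijection

end Roots

/-! ### Root vectors -/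

section RootVectors

open LieAlgebra.IsKilling

theorem apply_eq_zero_of_lie_eq_smul {k L : Type*} [Field k] [LieRing L] [LieAlgebra k L]
    {B : LinearMap.BilinForm k L} (hB : B.lieInvariant L) {h x y : L} {a c : k}
    (hx : ⁅h, x⁆ = a • x) (hy : ⁅h, y⁆ = c • y) (hac : a + c ≠ 0) : B x y = 0 := by
  have hinv := hB h x y
  rw [hx, hy, map_smul, map_smul, LinearMap.smul_apply, smul_eq_mul, smul_eq_mul] at hinv
  have hzero : (a + c) * B x y = 0 := by linear_combination hinv
  exact (mul_eq_zero.1 hzero).resolve_left hac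

variable {k L : Type*} [Field k] [LieRing L] [LieAlgebra k L]
  [FiniteDimensional k L] [LieAlgebra.IsKilling k L] {H : LieSubalgebra k L}
  [H.IsCartanSubalgebra] [LieModule.IsTriangularizable k H L]

/-- The opposite of a root, as a root. -/
def negRoot (α : H.root) : H.root := ⟨-α.1, by simpa using H.isNonZero_coe_root α⟩

theorem negRoot_negRoot (α : H.root) : negRoot (negRoot α) = α := Subtype.ext (neg_neg α.1)

theorem negRoot_injective : Function.Injective (negRoot : H.root → H.root) :=
  Function.LeftInverse.injective negRoot_negRoot

variable [CharZero k]

theorem exists_smul_eq_of_mem_rootSpace {α : LieModule.Weight k H L} (hα : α.IsNonZero) {x y : L}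
    (hx : x ∈ LieAlgebra.rootSpace H α) (hx0 : x ≠ 0) (hy : y ∈ LieAlgebra.rootSpace H α) :
    ∃ c : k, c • x = y := by
  obtain ⟨c, hc⟩ := (finrank_eq_one_iff_of_nonzero' (⟨x, hx⟩ : LieAlgebra.rootSpace H α)
    fun h => hx0 (congrArg Subtype.val h)).1 (finrank_rootSpace_eq_one α hα) ⟨y, hy⟩
  exact ⟨c, congrArg Subtype.val hc⟩

theorem root_negRoot (α : H.root) :
    (rootSystem H).root (negRoot α) = -(rootSystem H).root α := rfl

theorem eq_negRoot {α β : H.root} (h : (rootSystem H).root α + (rootSystem H).root β = 0) :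
    β = negRoot α :=
  (rootSystem H).root.injective (by rw [root_negRoot, eq_neg_iff_add_eq_zero, add_comm, h])

variable {b : (rootSystem H).Base}

theorem isPos_negRoot {α : H.root} : b.IsPos (negRoot α) ↔ ¬b.IsPos α :=
  isPos_neg_iff b (root_negRoot α)

theorem heightOff_negRoot (Γ : Finset H.root) (α : H.root) :
    heightOff b Γ (negRoot α) = -heightOff b Γ α :=
  heightOff_neg b (root_negRoot α)

end RootVectors

/-! ### Admissible triples -/

namespace AdmissibleTriple

open LieAlgebra.IsKilling

variable {𝔤 : Type*} [LieRing 𝔤] [LieAlgebra ℂ 𝔤] [FiniteDimensional ℂ 𝔤]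
  [LieAlgebra.IsSimple ℂ 𝔤] {H : LieSubalgebra ℂ 𝔤} [H.IsCartanSubalgebra]
  {b : (rootSystem H).Base} {T : AdmissibleTriple H b} {α α' β β' γ : H.root}

theorem Ext.neg (h : T.Ext α β) : T.Ext (negRoot α) (negRoot β) :=
  SpanMap.neg h (root_negRoot α) (root_negRoot β)

theorem Ext.right_unique (h : T.Ext α β) (h' : T.Ext α β') : β = β' :=
  SpanMap.right_unique T.Γ₁_subset T.Γ₂_subset T.bijOn h h'

theorem Ext.left_unique (h : T.Ext α β) (h' : T.Ext α' β) : α = α' :=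
  SpanMap.left_unique T.Γ₁_subset T.Γ₂_subset T.bijOn h h'

theorem Ext.isPos (h : T.Ext α β) (hα : b.IsPos α) : b.IsPos β :=
  SpanMap.isPos T.Γ₁_subset T.Γ₂_subset T.bijOn h hα

theorem Ext.isPos_iff (h : T.Ext α β) : b.IsPos α ↔ b.IsPos β := by
  refine ⟨h.isPos, fun hβ => ?_⟩
  by_contra hα
  exact isPos_negRoot.1 (h.neg.isPos (isPos_negRoot.2 hα)) hβ

theorem Ext.heightOff_left (h : T.Ext α β) : heightOff b T.Γ₁ α = 0 :=
  ((spanMap_iff T.Γ₁_subset T.Γ₂_subset T.bijOn).1 h).1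

theorem Ext.heightOff_right (h : T.Ext α β) : heightOff b T.Γ₂ β = 0 :=
  ((spanMap_iff T.Γ₁_subset T.Γ₂_subset T.bijOn).1 h).2.1

variable (T) in
theorem wellFounded_ext : WellFounded fun β α => T.Ext α β :=
  wellFounded_spanMap T.Γ₁_subset T.Γ₂_subset T.bijOn fun α hα =>
    let ⟨β, _, hβ⟩ := T.nilpotent α hα
    ⟨β, hβ⟩

theorem not_transGen_ext (α : H.root) : ¬Relation.TransGen T.Ext α α := fun h =>
  T.wellFounded_ext.transGen.irrefl.irrefl α (Relation.transGen_swap.2 h)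

variable (T) in
theorem wellFounded_ext_swap : WellFounded T.Ext := by
  have : IsTrans H.root (Relation.TransGen T.Ext) := ⟨fun _ _ _ => Relation.TransGen.trans⟩
  have : Std.Irrefl (Relation.TransGen T.Ext) := ⟨not_transGen_ext⟩
  exact Subrelation.wf Relation.TransGen.single
    (Finite.wellFounded_of_trans_of_irrefl (Relation.TransGen T.Ext))

theorem not_prec_self (α : H.root) : ¬T.Prec α α := fun h =>
  not_transGen_ext α (Relation.TransGen.mono (fun _ _ h => h.2) α α h)

theorem Prec.isPos_left (h : T.Prec α β) : b.IsPos α := by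
  obtain ⟨_, ⟨hα, -⟩, -⟩ := Relation.TransGen.head'_iff.1 h
  exact hα

theorem Prec.isPos_right (h : T.Prec α β) : b.IsPos β := by
  obtain ⟨_, -, hγ, hγβ⟩ := Relation.TransGen.tail'_iff.1 h
  exact hγβ.isPos hγ

theorem Prec.heightOff_left (h : T.Prec α β) : heightOff b T.Γ₁ α = 0 := by
  obtain ⟨_, ⟨-, hαγ⟩, -⟩ := Relation.TransGen.head'_iff.1 h
  exact hαγ.heightOff_left

theorem Prec.heightOff_right (h : T.Prec α β) : heightOff b T.Γ₂ β = 0 := by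
  obtain ⟨_, -, -, hγβ⟩ := Relation.TransGen.tail'_iff.1 h
  exact hγβ.heightOff_right

theorem prec_iff_left (hα : b.IsPos α) (h : T.Ext α α') : T.Prec α β ↔ β = α' ∨ T.Prec α' β := by
  rw [Prec, Relation.TransGen.head'_iff]
  constructor
  · rintro ⟨γ, ⟨-, hαγ⟩, hγβ⟩
    obtain rfl := h.right_unique hαγ
    exact Relation.reflTransGen_iff_eq_or_transGen.1 hγβ
  · exact fun hβ => ⟨α', ⟨hα, h⟩, Relation.reflTransGen_iff_eq_or_transGen.2 hβ⟩

theorem prec_iff_right (hα : b.IsPos α) (h : T.Ext α α') : T.Prec γ α' ↔ γ = α ∨ T.Prec γ α := by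
  rw [Prec, Relation.TransGen.tail'_iff, eq_comm]
  constructor
  · rintro ⟨β, hγβ, -, hβα'⟩
    obtain rfl := h.left_unique hβα'
    exact Relation.reflTransGen_iff_eq_or_transGen.1 hγβ
  · exact fun hγ => ⟨α, Relation.reflTransGen_iff_eq_or_transGen.2 hγ, hα, h⟩

end AdmissibleTriple

/-! ### Root vectors in Belavin–Drinfeld data -/

namespace BDData

open LieAlgebra.IsKilling

variable {𝔤 : Type*} [LieRing 𝔤] [LieAlgebra ℂ 𝔤] [FiniteDimensional ℂ 𝔤]
  [LieAlgebra.IsSimple ℂ 𝔤] {F : Type*} [Field F] [Algebra ℂ F] (D : BDData 𝔤 F)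

/-- The root system of the Cartan subalgebra of `D`. -/
abbrev P := rootSystem D.H

/-- The restriction of the invariant form to the Cartan subalgebra. -/
def BH : LinearMap.BilinForm ℂ D.H :=
  D.B.compl₁₂ D.H.toSubmodule.subtype D.H.toSubmodule.subtype

theorem BH_apply (h h' : D.H) : D.BH h h' = D.B h h' := rfl

theorem BH_symm : D.BH.IsSymm := ⟨fun x y => D.B_symm.eq x y⟩

theorem BH_t (k : Fin (Module.finrank ℂ D.H)) (h : D.H) : D.BH h (D.t k) = D.t.repr h k := by
  conv_lhs => rw [← D.t.sum_repr h]
  rw [map_sum, LinearMap.sum_apply]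
  simp [BH_apply, D.t_orthonormal]

theorem BH_separatingLeft : D.BH.SeparatingLeft := fun h hh =>
  D.t.repr.injective (Finsupp.ext fun k => by rw [← BH_t, hh, map_zero, Finsupp.zero_apply])

theorem BH_eq_sum (h h' : D.H) : D.BH h h' = ∑ k, D.BH h (D.t k) * D.BH h' (D.t k) := by
  conv_lhs => rw [← D.t.sum_repr h']
  simp only [map_sum, map_smul, smul_eq_mul]
  exact Finset.sum_congr rfl fun k _ => by rw [BH_t, BH_t, mul_comm]

theorem lie_coe_coe (h h' : D.H) : ⁅(h : 𝔤), (h' : 𝔤)⁆ = 0 :=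
  congrArg Subtype.val (trivial_lie_zero D.H D.H h h')

theorem lie_e (α : D.H.root) (h : D.H) : ⁅(h : 𝔤), D.e α⁆ = D.P.root α h • D.e α :=
  lie_eq_smul_of_mem_rootSpace (D.e_mem α) h

theorem B_e_negRoot (α : D.H.root) : D.B (D.e α) (D.e (negRoot α)) = 1 := D.e_normalized α

theorem e_ne_zero (α : D.H.root) : D.e α ≠ 0 := by
  intro h
  have hnorm := D.e_normalized α
  rw [h, map_zero, LinearMap.zero_apply] at hnorm
  exact zero_ne_one hnorm

theorem B_e_e {α β : D.H.root} (h : β ≠ negRoot α) : D.B (D.e α) (D.e β) = 0 := by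
  obtain ⟨x, hx⟩ : ∃ x : D.H, D.P.root α x + D.P.root β x ≠ 0 := by
    by_contra! hx
    exact h (eq_negRoot (LinearMap.ext hx))
  exact apply_eq_zero_of_lie_eq_smul D.B_invariant (D.lie_e α x) (D.lie_e β x) hx

theorem B_coe_e (h : D.H) (α : D.H.root) : D.B h (D.e α) = 0 := by
  obtain ⟨x, hx⟩ : ∃ x : D.H, D.P.root α x ≠ 0 := by
    by_contra! hx
    exact D.P.ne_zero α (LinearMap.ext hx)
  refine apply_eq_zero_of_lie_eq_smul D.B_invariant (h := x) (a := 0) ?_ (D.lie_e α x) ?_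
  · rw [lie_coe_coe, zero_smul]
  · rwa [zero_add]

theorem lie_e_e (α β : D.H.root) : β = negRoot α ∨
    (∃ γ, D.P.root γ = D.P.root α + D.P.root β ∧ ∃ c : ℂ, ⁅D.e α, D.e β⁆ = c • D.e γ) ∨
    ⁅D.e α, D.e β⁆ = 0 := by
  by_cases hsum : D.P.root α + D.P.root β = 0
  · exact .inl (eq_negRoot hsum)
  by_cases hlie : ⁅D.e α, D.e β⁆ = 0
  · exact .inr (.inr hlie)
  have hmem : ⁅D.e α, D.e β⁆ ∈ LieAlgebra.rootSpace D.H (α.1 + β.1 : D.H → ℂ) :=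
    LieAlgebra.lie_mem_genWeightSpace_of_mem_genWeightSpace (D.e_mem α) (D.e_mem β)
  let χ : LieModule.Weight ℂ D.H 𝔤 := ⟨α.1 + β.1, fun h => hlie (by simpa [h] using hmem)⟩
  have hχ : χ.IsNonZero := fun h => hsum (LinearMap.ext fun x => congrFun h x)
  let γ : D.H.root := ⟨χ, by simpa [LieSubalgebra.root] using hχ⟩
  obtain ⟨c, hc⟩ := exists_smul_eq_of_mem_rootSpace hχ (D.e_mem γ) (D.e_ne_zero γ) hmem
  exact .inr (.inl ⟨γ, rfl, c, hc.symm⟩)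

theorem eq_top_of_mem {W : Submodule ℂ 𝔤} (hH : ∀ h : D.H, (h : 𝔤) ∈ W)
    (he : ∀ α : D.H.root, D.e α ∈ W) : W = ⊤ := by
  rw [eq_top_iff, ← LieSubmodule.top_toSubmodule (R := ℂ) (L := D.H) (M := 𝔤),
    ← LieModule.iSup_genWeightSpace_eq_top' ℂ D.H 𝔤, LieSubmodule.iSup_toSubmodule, iSup_le_iff]
  intro χ x hx
  by_cases hχ : χ.IsZero
  · have hx' : x ∈ LieAlgebra.rootSpace D.H (0 : D.H → ℂ) := hχ ▸ hx
    rw [LieAlgebra.rootSpace_zero_eq, LieSubalgebra.mem_toLieSubmodule] at hx'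
    exact hH ⟨x, hx'⟩
  · let γ : D.H.root := ⟨χ, by simpa [LieSubalgebra.root] using hχ⟩
    obtain ⟨c, rfl⟩ := exists_smul_eq_of_mem_rootSpace hχ (D.e_mem γ) (D.e_ne_zero γ) hx
    exact W.smul_mem c (he γ)

/-- The element of the Cartan subalgebra which the form identifies with the root `α`; see
`BH_dualElt`. It is expressed in terms of the identification given by the Killing form, of which
`B` is a multiple. -/
def dualElt (α : D.H.root) : D.H :=
  killingForm ℂ 𝔤 (D.e α) (D.e (negRoot α)) • (cartanEquivDual D.H).symm (D.P.root α)

theorem lie_e_negRoot (α : D.H.root) : ⁅D.e α, D.e (negRoot α)⁆ = (D.dualElt α : 𝔤) :=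
  lie_eq_killingForm_smul_of_mem_rootSpace_of_mem_rootSpace_neg (D.e_mem α) (D.e_mem (negRoot α))

theorem BH_dualElt (α : D.H.root) (h : D.H) : D.BH (D.dualElt α) h = D.P.root α h := by
  rw [BH_apply, ← lie_e_negRoot, lieInvariant_apply_lie D.B_invariant, ← lie_skew, lie_e,
    root_negRoot, LinearMap.neg_apply, neg_smul, neg_neg, map_smul, B_e_negRoot, smul_eq_mul,
    mul_one]

theorem root_dualElt (α β : D.H.root) :
    D.P.root β (D.dualElt α) = ∑ k, β.1 (D.t k) * α.1 (D.t k) := by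
  rw [← BH_dualElt, BH_eq_sum]
  simp only [BH_dualElt]
  rfl

theorem pairing_eq_div (α β : D.H.root) : D.P.pairing β α
    = 2 * (D.P.root β (D.dualElt α) / D.P.root α (D.dualElt α)) := by
  have hk : killingForm ℂ 𝔤 (D.e α) (D.e (negRoot α)) ≠ 0 := by
    intro hk
    refine D.P.ne_zero α (LinearMap.ext fun h => ?_)
    rw [← BH_dualElt, dualElt, hk, zero_smul, map_zero, LinearMap.zero_apply]
  have hcoroot : coroot α.1 = (2 : ℕ) • (D.P.root α ((cartanEquivDual D.H).symm (D.P.root α)))⁻¹ •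
    (cartanEquivDual D.H).symm (D.P.root α) := rfl
  have hpairing : D.P.pairing β α = D.P.root β (coroot α.1) := rfl
  rw [hpairing, hcoroot, dualElt]
  simp only [map_nsmul, map_smul, smul_eq_mul, nsmul_eq_mul]
  rw [mul_div_mul_left _ _ hk]
  push_cast
  ring

theorem pairing_τ : ∀ α ∈ D.triple.Γ₁, ∀ β ∈ D.triple.Γ₁,
    D.P.pairing (D.triple.τ α) (D.triple.τ β) = D.P.pairing α β := by
  intro α hα β hβ
  simp only [pairing_eq_div, root_dualElt, D.isometric α hα β hβ, D.isometric β hβ β hβ]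

theorem exists_ext {α : D.H.root} (h : heightOff D.base D.triple.Γ₁ α = 0) :
    ∃ β, D.triple.Ext α β :=
  exists_spanMap D.pairing_τ h

theorem exists_ext_left {β : D.H.root} (h : heightOff D.base D.triple.Γ₂ β = 0) :
    ∃ α, D.triple.Ext α β :=
  exists_spanMap_left D.triple.Γ₁_subset D.triple.Γ₂_subset D.triple.bijOn D.pairing_τ h

end BDData

/-! ### The Belavin–Drinfeld `r`-matrix as an operator -/

theorem baseChange_apply_baseChange {R A M N : Type*} [CommRing R] [CommRing A] [Algebra R A]
    [AddCommGroup M] [Module R M] [AddCommGroup N] [Module R N] (B : LinearMap.BilinForm R M)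
    (g : N →ₗ[R] M) (x y : A ⊗[R] N) :
    B.baseChange A (g.baseChange A x) (g.baseChange A y)
      = LinearMap.BilinForm.baseChange A (B.compl₁₂ g g) x y := by
  induction x using TensorProduct.induction_on with
  | zero => simp
  | add x x' h h' => simp only [map_add, LinearMap.add_apply, h, h']
  | tmul s x =>
    induction y using TensorProduct.induction_on with
    | zero => simp
    | add y y' h h' => simp only [map_add, h, h']
    | tmul s' y => simp

theorem isSymm_baseChange {R M : Type*} (A : Type*) [CommRing R] [CommRing A] [Algebra R A]
    [AddCommGroup M] [Module R M] {B : LinearMap.BilinForm R M} (hB : B.IsSymm) :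
    (B.baseChange A).IsSymm :=
  LinearMap.BilinForm.isSymm_iff.2
    (LinearMap.BilinForm.IsSymm.baseChange A (LinearMap.BilinForm.isSymm_iff.1 hB))

section FormExt

variable {F 𝔤 : Type*} [Field F] [Algebra ℂ F] [LieRing 𝔤] [LieAlgebra ℂ 𝔤]
  {H : LieSubalgebra ℂ 𝔤}

theorem formExt_tmul (χ : Module.Dual ℂ H) (s : F) (h : H) :
    formExt F χ (s ⊗ₜ h) = s * algebraMap ℂ F (χ h) := rfl

theorem formExt_sum {ι : Type*} (s : Finset ι) (m : ι → ℤ) (χ : ι → Module.Dual ℂ H)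
    (x : F ⊗[ℂ] H) : formExt F (∑ i ∈ s, m i • χ i) x = ∑ i ∈ s, m i • formExt F (χ i) x := by
  induction x using TensorProduct.induction_on with
  | zero => simp
  | add s t hs ht => simp only [map_add, hs, ht, smul_add, Finset.sum_add_distrib]
  | tmul u v => simp [formExt_tmul, Finset.mul_sum, mul_left_comm]

end FormExt

namespace BDData

variable {𝔤 : Type*} [LieRing 𝔤] [LieAlgebra ℂ 𝔤] [FiniteDimensional ℂ 𝔤]
  [LieAlgebra.IsSimple ℂ 𝔤] {F : Type*} [Field F] [Algebra ℂ F] (D : BDData 𝔤 F)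

/-- A root vector as an element of `𝔤(F)`. -/
def eF (α : D.H.root) : F ⊗[ℂ] 𝔤 := 1 ⊗ₜ D.e α

/-- The inclusion of the Cartan subalgebra `F ⊗ H` in `𝔤(F)`. -/
def incl : F ⊗[ℂ] D.H →ₗ[F] F ⊗[ℂ] 𝔤 := D.H.toSubmodule.subtype.baseChange F

/-- The invariant form on `𝔤(F)`. -/
abbrev BF : LinearMap.BilinForm F (F ⊗[ℂ] 𝔤) := D.B.baseChange F

/-- The invariant form on the Cartan subalgebra `F ⊗ H`. -/
abbrev BHF : LinearMap.BilinForm F (F ⊗[ℂ] D.H) := D.BH.baseChange F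

theorem incl_tmul (s : F) (h : D.H) : D.incl (s ⊗ₜ h) = s ⊗ₜ (h : 𝔤) := rfl

theorem BF_symm : D.BF.IsSymm := isSymm_baseChange F D.B_symm

theorem BHF_symm : D.BHF.IsSymm := isSymm_baseChange F D.BH_symm

theorem BF_incl_incl (x y : F ⊗[ℂ] D.H) : D.BF (D.incl x) (D.incl y) = D.BHF x y :=
  baseChange_apply_baseChange D.B D.H.toSubmodule.subtype x y

theorem BF_incl_eF (x : F ⊗[ℂ] D.H) (α : D.H.root) : D.BF (D.incl x) (D.eF α) = 0 := by
  induction x using TensorProduct.induction_on with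
  | zero => simp
  | add x x' h h' => simp only [map_add, LinearMap.add_apply, h, h', add_zero]
  | tmul s x => rw [incl_tmul, eF, LinearMap.BilinForm.baseChange_tmul, B_coe_e, zero_smul]

theorem BF_eF_incl (x : F ⊗[ℂ] D.H) (α : D.H.root) : D.BF (D.eF α) (D.incl x) = 0 := by
  rw [D.BF_symm.eq, BF_incl_eF]

theorem BF_eF_eF (α β : D.H.root) [Decidable (α = negRoot β)] :
    D.BF (D.eF α) (D.eF β) = if α = negRoot β then 1 else 0 := by
  rw [eF, eF, LinearMap.BilinForm.baseChange_tmul, one_mul]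
  split_ifs with h
  · rw [h, D.B_symm.eq, B_e_negRoot, one_smul]
  · rw [D.B_symm.eq, B_e_e D h, zero_smul]

theorem lie_incl_eF (x : F ⊗[ℂ] D.H) (α : D.H.root) :
    ⁅D.incl x, D.eF α⁆ = formExt F (D.P.root α) x • D.eF α := by
  induction x using TensorProduct.induction_on with
  | zero => simp
  | add x x' h h' => simp only [map_add, add_lie, h, h', add_smul]
  | tmul s x =>
    rw [incl_tmul, eF, LieAlgebra.ExtendScalars.bracket_tmul, lie_e, formExt_tmul, mul_one,
      mul_smul, algebraMap_smul, ← TensorProduct.tmul_smul, TensorProduct.smul_tmul', smul_eq_mul,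
      mul_one]

theorem lie_incl_incl (x y : F ⊗[ℂ] D.H) : ⁅D.incl x, D.incl y⁆ = 0 := by
  induction x using TensorProduct.induction_on with
  | zero => simp
  | add x x' h h' => simp only [map_add, add_lie, h, h', add_zero]
  | tmul s x =>
    induction y using TensorProduct.induction_on with
    | zero => simp
    | add x x' h h' => simp only [map_add, lie_add, h, h', add_zero]
    | tmul s' y =>
      rw [incl_tmul, incl_tmul, LieAlgebra.ExtendScalars.bracket_tmul, lie_coe_coe,
        TensorProduct.tmul_zero]

theorem eq_top_of_incl_mem_of_eF_mem {W : Submodule F (F ⊗[ℂ] 𝔤)} (hH : ∀ x, D.incl x ∈ W)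
    (he : ∀ α, D.eF α ∈ W) : W = ⊤ := by
  have hcomap : (W.restrictScalars ℂ).comap (TensorProduct.mk ℂ F 𝔤 1) = ⊤ :=
    D.eq_top_of_mem (fun h => hH (1 ⊗ₜ h)) he
  refine eq_top_iff.2 fun x _ => ?_
  induction x using TensorProduct.induction_on with
  | zero => exact W.zero_mem
  | add x y hx hy => exact W.add_mem (hx trivial) (hy trivial)
  | tmul s x =>
    have hx : (1 : F) ⊗ₜ[ℂ] x ∈ W := Submodule.mem_comap.1 (hcomap ▸ Submodule.mem_top)
    simpa [TensorProduct.smul_tmul'] using W.smul_mem s hx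

section CartanPart

/-- The operator on `F ⊗ H` attached to `r₀`. -/
def f₀ : F ⊗[ℂ] D.H →ₗ[F] F ⊗[ℂ] D.H := tensorOp D.BHF D.r₀

theorem tensorOp_sum_t (x : F ⊗[ℂ] D.H) :
    tensorOp D.BHF (∑ k, ((1 : F) ⊗ₜ[ℂ] D.t k) ⊗ₜ[F] ((1 : F) ⊗ₜ[ℂ] D.t k)) x = x := by
  rw [map_sum, LinearMap.sum_apply]
  induction x using TensorProduct.induction_on with
  | zero => simp
  | add x y hx hy => simp only [map_add, Finset.sum_add_distrib, hx, hy]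
  | tmul s x =>
    conv_rhs => rw [← D.t.sum_repr x, TensorProduct.tmul_sum]
    refine Finset.sum_congr rfl fun k _ => ?_
    rw [tensorOp_tmul, LinearMap.BilinForm.baseChange_tmul, D.BH_symm.eq, BH_t, one_mul,
      TensorProduct.smul_tmul', TensorProduct.tmul_smul, TensorProduct.smul_tmul', smul_eq_mul,
      mul_one]

theorem tensorOp_comm_r₀ (x : F ⊗[ℂ] D.H) :
    tensorOp D.BHF (TensorProduct.comm F _ _ D.r₀) x = x - D.f₀ x := by
  have hsum := tensorOp_sum_t D x
  rw [← D.r₀_symm, map_add, LinearMap.add_apply] at hsum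
  rw [eq_sub_iff_add_eq, add_comm]
  exact hsum

theorem formExt_f₀ {α α' : D.H.root} (h : D.triple.Ext α α') (x : F ⊗[ℂ] D.H) :
    formExt F (D.P.root α) (D.f₀ x) = formExt F (D.P.root α') (D.f₀ x - x) := by
  obtain ⟨m, hα, hα'⟩ := h
  change D.P.root α = _ at hα
  change D.P.root α' = _ at hα'
  rw [hα, hα', formExt_sum, formExt_sum]
  refine Finset.sum_congr rfl fun γ hγ => congrArg (m γ • ·) ?_
  have hr₀ := congrArg (fun y => D.BHF y x) (D.r₀_triple γ hγ)
  simp only [map_add, LinearMap.add_apply, map_zero, LinearMap.zero_apply] at hr₀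
  rw [apply_lid_rTensor, apply_rid_lTensor, tensorOp_comm_r₀, ← f₀] at hr₀
  rwa [← neg_sub x, map_neg, eq_neg_iff_add_eq_zero, add_comm]

theorem BHF_dualElt (α : D.H.root) (x : F ⊗[ℂ] D.H) :
    D.BHF ((1 : F) ⊗ₜ D.dualElt α) x = formExt F (D.P.root α) x := by
  induction x using TensorProduct.induction_on with
  | zero => simp
  | add s t hs ht => simp only [map_add, hs, ht]
  | tmul s x =>
    rw [LinearMap.BilinForm.baseChange_tmul, BH_dualElt, formExt_tmul, one_mul, Algebra.smul_def,
      mul_comm]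

theorem f₀_dualElt {α α' : D.H.root} (h : D.triple.Ext α α') :
    D.f₀ ((1 : F) ⊗ₜ D.dualElt α - (1 : F) ⊗ₜ D.dualElt α') = (1 : F) ⊗ₜ D.dualElt α := by
  refine sub_eq_zero.1 (separatingLeft_baseChange F D.BH_separatingLeft _ fun x => ?_)
  rw [map_sub, LinearMap.sub_apply, sub_eq_zero]
  set z := (1 : F) ⊗ₜ[ℂ] D.dualElt α - (1 : F) ⊗ₜ[ℂ] D.dualElt α'
  calc D.BHF (D.f₀ z) x = D.BHF z (x - D.f₀ x) := by
        rw [D.BHF_symm.eq, ← tensorOp_comm_r₀, D.BHF_symm.eq z, apply_tensorOp_comm,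
          D.BHF_symm.eq x, f₀]
    _ = formExt F (D.P.root α) x - formExt F (D.P.root α) (D.f₀ x)
          + formExt F (D.P.root α') (D.f₀ x - x) := by
        simp only [z, map_sub, LinearMap.sub_apply, BHF_dualElt]
        ring
    _ = D.BHF ((1 : F) ⊗ₜ D.dualElt α) x := by
        rw [D.formExt_f₀ h, sub_add_cancel, BHF_dualElt]

end CartanPart

/-- The operator on `𝔤(F)` attached to the `r`-matrix. -/
def f : F ⊗[ℂ] 𝔤 →ₗ[F] F ⊗[ℂ] 𝔤 := tensorOp D.BF D.r

theorem tensorOp_map_incl_eF (t : (F ⊗[ℂ] D.H) ⊗[F] (F ⊗[ℂ] D.H)) (α : D.H.root) :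
    tensorOp D.BF (TensorProduct.map D.incl D.incl t) (D.eF α) = 0 := by
  induction t using TensorProduct.induction_on with
  | zero => simp
  | add s t hs ht => simp only [map_add, LinearMap.add_apply, hs, ht, add_zero]
  | tmul u v => rw [TensorProduct.map_tmul, tensorOp_tmul, BF_incl_eF, zero_smul]

theorem tensorOp_tens (α β : D.H.root) (x : F ⊗[ℂ] 𝔤) :
    tensorOp D.BF (tens F (D.e α) (D.e β)) x = D.BF (D.eF α) x • D.eF β := rfl

open Classical in
theorem r_eq : D.r = TensorProduct.map D.incl D.incl D.r₀
    + ∑ α : D.H.root with D.base.IsPos α, tens F (D.e (negRoot α)) (D.e α)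
    + ∑ α : D.H.root, ∑ β : D.H.root with D.triple.Prec α β,
        (tens F (D.e (negRoot α)) (D.e β) - tens F (D.e β) (D.e (negRoot α))) := rfl

open Classical in
theorem f_apply (x : F ⊗[ℂ] 𝔤) : D.f x
    = tensorOp D.BF (TensorProduct.map D.incl D.incl D.r₀) x
    + ∑ α : D.H.root with D.base.IsPos α, D.BF (D.eF (negRoot α)) x • D.eF α
    + ∑ α : D.H.root, ∑ β : D.H.root with D.triple.Prec α β,
        (D.BF (D.eF (negRoot α)) x • D.eF β - D.BF (D.eF β) x • D.eF (negRoot α)) := by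
  simp only [f, r_eq, map_add, map_sum, map_sub, LinearMap.add_apply, LinearMap.sum_apply,
    LinearMap.sub_apply, tensorOp_tens]

theorem f_incl (x : F ⊗[ℂ] D.H) : D.f (D.incl x) = D.incl (D.f₀ x) := by
  rw [f_apply, tensorOp_map D.BF_incl_incl]
  simp only [BF_eF_incl, zero_smul, sub_self, Finset.sum_const_zero, add_zero]
  rfl

open Classical in
theorem f_eF (α : D.H.root) : D.f (D.eF α)
    = (if D.base.IsPos α then D.eF α else 0)
    + ∑ β : D.H.root with D.triple.Prec α β, D.eF β
    - ∑ γ : D.H.root with D.triple.Prec γ (negRoot α), D.eF (negRoot γ) := by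
  rw [f_apply, tensorOp_map_incl_eF, zero_add, add_sub_assoc]
  simp only [BF_eF_eF, negRoot_injective.eq_iff, ite_smul, one_smul, zero_smul,
    Finset.sum_sub_distrib, Finset.sum_ite_eq', Finset.mem_filter, Finset.mem_univ, true_and,
    ← Finset.sum_filter]
  congr 2
  rw [Finset.sum_eq_single α (fun β _ h => by simp [h]) (by simp)]
  simp

theorem sum_prec_left_eq_zero {α : D.H.root} (hα : ¬D.base.IsPos α)
    [DecidablePred (D.triple.Prec α)] : ∑ β : D.H.root with D.triple.Prec α β, D.eF β = 0 :=
  Finset.sum_eq_zero fun _ hβ => absurd (Finset.mem_filter.1 hβ).2.isPos_left hα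

theorem sum_prec_right_eq_zero {α : D.H.root} (hα : D.base.IsPos α)
    [DecidablePred fun γ => D.triple.Prec γ (negRoot α)] :
    ∑ γ : D.H.root with D.triple.Prec γ (negRoot α), D.eF (negRoot γ) = 0 :=
  Finset.sum_eq_zero fun _ hγ =>
    absurd hα (isPos_negRoot.1 (Finset.mem_filter.1 hγ).2.isPos_right)

theorem f_eF_of_heightOff_pos {α : D.H.root} (h : 0 < heightOff D.base D.triple.Γ₁ α) :
    D.f (D.eF α) = D.eF α := by
  classical
  have hα := isPos_of_heightOff_pos D.base h
  rw [f_eF, if_pos hα, D.sum_prec_right_eq_zero hα, sub_zero, add_eq_left]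
  exact Finset.sum_eq_zero fun _ hβ =>
    absurd (Finset.mem_filter.1 hβ).2.heightOff_left h.ne'

theorem f_eF_of_heightOff_neg {α : D.H.root} (h : heightOff D.base D.triple.Γ₂ α < 0) :
    D.f (D.eF α) = 0 := by
  classical
  have hα := not_isPos_of_heightOff_neg D.base h
  rw [f_eF, if_neg hα, D.sum_prec_left_eq_zero hα, zero_add, zero_sub, neg_eq_zero]
  refine Finset.sum_eq_zero fun γ hγ => ?_
  have hγ' := (Finset.mem_filter.1 hγ).2.heightOff_right
  rw [heightOff_negRoot, neg_eq_zero] at hγ'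
  exact absurd hγ' h.ne

/-- The sums over the `τ`-orbits of `α` and of `τ(α)` telescope. -/
theorem f_eF_sub {α α' : D.H.root} (h : D.triple.Ext α α') :
    D.f (D.eF α - D.eF α') = D.eF α := by
  classical
  rw [map_sub, f_eF, f_eF]
  by_cases hα : D.base.IsPos α
  · have hα' := h.isPos hα
    have horbit : (Finset.univ.filter fun β => D.triple.Prec α β)
        = insert α' (Finset.univ.filter fun β => D.triple.Prec α' β) := by
      ext β
      simp [AdmissibleTriple.prec_iff_left hα h]
    rw [D.sum_prec_right_eq_zero hα, D.sum_prec_right_eq_zero hα', if_pos hα, if_pos hα', horbit,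
      Finset.sum_insert (by simpa using AdmissibleTriple.not_prec_self α')]
    abel
  · have hα' : ¬D.base.IsPos α' := mt h.isPos_iff.2 hα
    have horbit : (Finset.univ.filter fun γ => D.triple.Prec γ (negRoot α'))
        = insert (negRoot α) (Finset.univ.filter fun γ => D.triple.Prec γ (negRoot α)) := by
      ext γ
      simp [AdmissibleTriple.prec_iff_right (isPos_negRoot.2 hα) h.neg]
    rw [D.sum_prec_left_eq_zero hα, D.sum_prec_left_eq_zero hα', if_neg hα, if_neg hα', horbit,
      Finset.sum_insert (by simpa using AdmissibleTriple.not_prec_self (negRoot α)),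
      negRoot_negRoot]
    abel

open Classical in
theorem r_add_comm : D.r + TensorProduct.comm F _ _ D.r
    = TensorProduct.map D.incl D.incl
        (∑ k, ((1 : F) ⊗ₜ[ℂ] D.t k) ⊗ₜ[F] ((1 : F) ⊗ₜ[ℂ] D.t k))
      + ∑ α : D.H.root with D.base.IsPos α,
        (tens F (D.e (negRoot α)) (D.e α) + tens F (D.e α) (D.e (negRoot α))) := by
  have hcomm₀ : TensorProduct.comm F _ _ (TensorProduct.map D.incl D.incl D.r₀)
      = TensorProduct.map D.incl D.incl (TensorProduct.comm F _ _ D.r₀) :=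
    (TensorProduct.map_comm D.incl D.incl D.r₀).symm
  have hcomm (x y : 𝔤) : TensorProduct.comm F _ _ (tens F x y) = tens F y x := rfl
  rw [← D.r₀_symm, r_eq]
  simp only [map_add, map_sum, map_sub, hcomm₀, hcomm, Finset.sum_add_distrib,
    Finset.sum_sub_distrib]
  abel

theorem tensorOp_r_add_comm :
    tensorOp D.BF (D.r + TensorProduct.comm F _ _ D.r) = LinearMap.id := by
  classical
  refine LinearMap.eqLocus_eq_top.1 (D.eq_top_of_incl_mem_of_eF_mem (fun x => ?_) fun α => ?_)
  · rw [LinearMap.mem_eqLocus, r_add_comm, map_add, LinearMap.add_apply,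
      tensorOp_map D.BF_incl_incl, tensorOp_sum_t, map_sum, LinearMap.sum_apply]
    simp only [map_add, LinearMap.add_apply, tensorOp_tens, BF_eF_incl, zero_smul, add_zero,
      Finset.sum_const_zero, LinearMap.id_apply]
  · rw [LinearMap.mem_eqLocus, r_add_comm, map_add, LinearMap.add_apply,
      tensorOp_map_incl_eF, map_sum, LinearMap.sum_apply, zero_add, LinearMap.id_apply]
    simp only [map_add, LinearMap.add_apply, tensorOp_tens, Finset.sum_add_distrib, BF_eF_eF,
      negRoot_injective.eq_iff, ite_smul, one_smul, zero_smul, Finset.sum_ite_eq',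
      Finset.mem_filter, Finset.mem_univ, true_and, negRoot_negRoot, isPos_negRoot]
    by_cases hα : D.base.IsPos α <;> simp [hα]

theorem BF_f_add_BF_f (x y : F ⊗[ℂ] 𝔤) :
    D.BF (D.f x) y + D.BF x (D.f y) = D.BF x y := by
  have hy : D.f y + tensorOp D.BF (TensorProduct.comm F _ _ D.r) y = y := by
    simpa only [map_add] using! DFunLike.congr_fun D.tensorOp_r_add_comm y
  conv_rhs => rw [← hy, map_add, D.BF_symm.eq x (tensorOp _ _ y), apply_tensorOp_comm, add_comm]
  rfl

end BDData

/-! ### The Belavin–Drinfeld `r`-matrix defines a Lie bialgebra -/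

namespace BDData

variable {𝔤 : Type*} [LieRing 𝔤] [LieAlgebra ℂ 𝔤] [FiniteDimensional ℂ 𝔤]
  [LieAlgebra.IsSimple ℂ 𝔤] {F : Type*} [Field F] [Algebra ℂ F] (D : BDData 𝔤 F)

theorem eF_lie_eF (α β : D.H.root) : ⁅D.eF α, D.eF β⁆ = 1 ⊗ₜ ⁅D.e α, D.e β⁆ := by
  rw [eF, eF, LieAlgebra.ExtendScalars.bracket_tmul, one_mul]

theorem tmul_smul_e (c : ℂ) (α : D.H.root) :
    (1 : F) ⊗ₜ[ℂ] (c • D.e α) = algebraMap ℂ F c • D.eF α := by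
  rw [TensorProduct.tmul_smul, eF, algebraMap_smul]

/-- The range of the Cayley map of `D.f`, that is, the pairs `(f z, f z - z)`. -/
abbrev graph : Submodule F ((F ⊗[ℂ] 𝔤) × (F ⊗[ℂ] 𝔤)) := LinearMap.range (cayley D.f)

/-- Generators of `D.graph`: the first component runs through the parabolic subalgebra attached
to `Γ₁` and the second one through the opposite parabolic attached to `Γ₂`, and `τ` identifies
their Levi factors. -/
inductive Gen : (F ⊗[ℂ] 𝔤) × (F ⊗[ℂ] 𝔤) → Prop
  | levi {α α' : D.H.root} (h : D.triple.Ext α α') : Gen (D.eF α, D.eF α')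
  | left {α : D.H.root} (h : 0 < heightOff D.base D.triple.Γ₁ α) : Gen (D.eF α, 0)
  | right {α : D.H.root} (h : heightOff D.base D.triple.Γ₂ α < 0) : Gen (0, D.eF α)
  | cartan (x : F ⊗[ℂ] D.H) : Gen (D.incl (D.f₀ x), D.incl (D.f₀ x - x))

variable {D}

theorem Gen.mem_graph {p : (F ⊗[ℂ] 𝔤) × (F ⊗[ℂ] 𝔤)} (hp : D.Gen p) : p ∈ D.graph := by
  rw [mem_range_cayley]
  cases hp with
  | levi h => exact D.f_eF_sub h
  | left h => rw [sub_zero, D.f_eF_of_heightOff_pos h]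
  | right h => rw [zero_sub, map_neg, D.f_eF_of_heightOff_neg h, neg_zero]
  | cartan x => rw [← map_sub, sub_sub_cancel, f_incl]

theorem tmul_dualElt_mem_graph {α α' : D.H.root} (h : D.triple.Ext α α') :
    ((1 : F) ⊗ₜ (D.dualElt α : 𝔤), (1 : F) ⊗ₜ (D.dualElt α' : 𝔤)) ∈ D.graph := by
  have hincl := congrArg D.incl (D.f₀_dualElt h)
  rw [← f_incl, map_sub] at hincl
  exact mem_range_cayley.2 hincl

theorem lie_zero_mem_graph {α β : D.H.root} (hα : 0 < heightOff D.base D.triple.Γ₁ α)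
    (hβ : 0 ≤ heightOff D.base D.triple.Γ₁ β) : (⁅D.eF α, D.eF β⁆, 0) ∈ D.graph := by
  rw [eF_lie_eF]
  rcases D.lie_e_e α β with rfl | ⟨γ, hγ, c, hc⟩ | hzero
  · rw [heightOff_negRoot] at hβ
    lia
  · have hγ' : D.Gen (D.eF γ, 0) := .left (by rw [heightOff_add D.base hγ]; lia)
    rw [hc, tmul_smul_e, ← smul_zero (algebraMap ℂ F c)]
    exact D.graph.smul_mem _ hγ'.mem_graph
  · rw [hzero, TensorProduct.tmul_zero]
    exact D.graph.zero_mem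

theorem zero_lie_mem_graph {α β : D.H.root} (hα : heightOff D.base D.triple.Γ₂ α < 0)
    (hβ : heightOff D.base D.triple.Γ₂ β ≤ 0) : (0, ⁅D.eF α, D.eF β⁆) ∈ D.graph := by
  rw [eF_lie_eF]
  rcases D.lie_e_e α β with rfl | ⟨γ, hγ, c, hc⟩ | hzero
  · rw [heightOff_negRoot] at hβ
    lia
  · have hγ' : D.Gen (0, D.eF γ) := .right (by rw [heightOff_add D.base hγ]; lia)
    rw [hc, tmul_smul_e, ← smul_zero (algebraMap ℂ F c)]
    exact D.graph.smul_mem _ hγ'.mem_graph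
  · rw [hzero, TensorProduct.tmul_zero]
    exact D.graph.zero_mem

theorem lie_levi_mem_graph {α α' β β' : D.H.root} (h : D.triple.Ext α α')
    (h' : D.triple.Ext β β') : (⁅D.eF α, D.eF β⁆, ⁅D.eF α', D.eF β'⁆) ∈ D.graph := by
  rw [eF_lie_eF, eF_lie_eF]
  rcases D.lie_e_e α β with rfl | ⟨γ, hγ, c, hc⟩ | hzero
  · obtain rfl := h'.right_unique h.neg
    rw [lie_e_negRoot, lie_e_negRoot]
    exact tmul_dualElt_mem_graph h
  · obtain ⟨γ', hγ'⟩ := D.exists_ext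
      (by rw [heightOff_add D.base hγ, h.heightOff_left, h'.heightOff_left, add_zero])
    rw [hc, D.e_compatible α β γ α' β' γ' h h' hγ' c hc, tmul_smul_e, tmul_smul_e]
    exact D.graph.smul_mem _ (Gen.levi hγ').mem_graph
  · rw [hzero, D.e_compatible α β α α' β' α' h h' h 0 (by rw [hzero, zero_smul]), zero_smul,
      TensorProduct.tmul_zero]
    exact D.graph.zero_mem

theorem Gen.lie_cartan_mem_graph {p : (F ⊗[ℂ] 𝔤) × (F ⊗[ℂ] 𝔤)} (x : F ⊗[ℂ] D.H)
    (hp : D.Gen p) : ⁅(D.incl (D.f₀ x), D.incl (D.f₀ x - x)), p⁆ ∈ D.graph := by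
  suffices h : (∃ c : F, ⁅(D.incl (D.f₀ x), D.incl (D.f₀ x - x)), p⁆ = c • p) ∨
      ⁅(D.incl (D.f₀ x), D.incl (D.f₀ x - x)), p⁆ = 0 by
    rcases h with ⟨c, hc⟩ | hzero
    · exact hc ▸ D.graph.smul_mem c hp.mem_graph
    · exact hzero ▸ D.graph.zero_mem
  cases hp with
  | levi h =>
    refine .inl ⟨formExt F (D.P.root _) (D.f₀ x), Prod.ext (lie_incl_eF D _ _) ?_⟩
    rw [D.formExt_f₀ h]
    exact lie_incl_eF D _ _
  | left h =>
    exact .inl ⟨_, Prod.ext (lie_incl_eF D _ _) ((lie_zero _).trans (smul_zero _).symm)⟩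
  | right h =>
    exact .inl ⟨_, Prod.ext ((lie_zero _).trans (smul_zero _).symm) (lie_incl_eF D _ _)⟩
  | cartan y => exact .inr (Prod.ext (lie_incl_incl D _ _) (lie_incl_incl D _ _))

theorem lie_mem_graph_comm {p q : (F ⊗[ℂ] 𝔤) × (F ⊗[ℂ] 𝔤)} :
    ⁅p, q⁆ ∈ D.graph ↔ ⁅q, p⁆ ∈ D.graph := by
  rw [← lie_skew, neg_mem_iff]

theorem Gen.lie_mem_graph {p q : (F ⊗[ℂ] 𝔤) × (F ⊗[ℂ] 𝔤)} (hp : D.Gen p) (hq : D.Gen q) :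
    ⁅p, q⁆ ∈ D.graph := by
  have hmk (x₁ x₂ y₁ y₂ : F ⊗[ℂ] 𝔤) : ⁅(x₁, x₂), (y₁, y₂)⁆ = (⁅x₁, y₁⁆, ⁅x₂, y₂⁆) := rfl
  cases hp with
  | cartan x => exact hq.lie_cartan_mem_graph x
  | levi h =>
    cases hq with
    | cartan y => exact lie_mem_graph_comm.1 ((Gen.levi h).lie_cartan_mem_graph y)
    | levi h' => exact lie_levi_mem_graph h h'
    | left h' =>
      rw [lie_mem_graph_comm, hmk, zero_lie]
      exact lie_zero_mem_graph h' h.heightOff_left.ge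
    | right h' =>
      rw [lie_mem_graph_comm, hmk, zero_lie]
      exact zero_lie_mem_graph h' h.heightOff_right.le
  | left h =>
    cases hq with
    | cartan y => exact lie_mem_graph_comm.1 ((Gen.left h).lie_cartan_mem_graph y)
    | levi h' =>
      rw [hmk, zero_lie]
      exact lie_zero_mem_graph h h'.heightOff_left.ge
    | left h' =>
      rw [hmk, zero_lie]
      exact lie_zero_mem_graph h h'.le
    | right h' =>
      rw [hmk, zero_lie, lie_zero]
      exact D.graph.zero_mem
  | right h =>
    cases hq with
    | cartan y => exact lie_mem_graph_comm.1 ((Gen.right h).lie_cartan_mem_graph y)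
    | levi h' =>
      rw [hmk, zero_lie]
      exact zero_lie_mem_graph h h'.heightOff_right.le
    | left h' =>
      rw [hmk, zero_lie, lie_zero]
      exact D.graph.zero_mem
    | right h' =>
      rw [hmk, zero_lie]
      exact zero_lie_mem_graph h h'.le

variable (D)

theorem span_gen : Submodule.span F ((fun p => p.1 - p.2) '' {p | D.Gen p}) = ⊤ := by
  set W := Submodule.span F ((fun p => p.1 - p.2) '' {p | D.Gen p})
  have hgen {x₁ x₂ : F ⊗[ℂ] 𝔤} (h : D.Gen (x₁, x₂)) : x₁ - x₂ ∈ W :=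
    Submodule.subset_span ⟨_, h, rfl⟩
  have hpos (α : D.H.root) (hα : D.base.IsPos α) : D.eF α ∈ W := by
    induction α using D.triple.wellFounded_ext.induction with
    | _ α ih =>
      have hheight : 0 ≤ heightOff D.base D.triple.Γ₁ α :=
        not_lt.1 fun h => not_isPos_of_heightOff_neg D.base h hα
      rcases hheight.eq_or_lt with h | h
      · obtain ⟨α', h'⟩ := D.exists_ext h.symm
        simpa using W.add_mem (hgen (.levi h')) (ih α' h' (h'.isPos hα))
      · simpa using hgen (.left h)
  have hneg (β : D.H.root) (hβ : ¬D.base.IsPos β) : D.eF β ∈ W := by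
    induction β using D.triple.wellFounded_ext_swap.induction with
    | _ β ih =>
      have hheight : heightOff D.base D.triple.Γ₂ β ≤ 0 :=
        not_lt.1 fun h => hβ (isPos_of_heightOff_pos D.base h)
      rcases hheight.eq_or_lt with h | h
      · obtain ⟨α, h'⟩ := D.exists_ext_left h
        simpa using W.sub_mem (ih α h' (mt h'.isPos hβ)) (hgen (.levi h'))
      · simpa using hgen (.right h)
  refine D.eq_top_of_incl_mem_of_eF_mem (fun x => ?_) fun α => ?_
  · simpa [← map_sub] using hgen (.cartan x)
  · exact (em (D.base.IsPos α)).elim (hpos α) (hneg α)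

theorem isLieCobracket_r : IsLieCobracket F (F ⊗[ℂ] 𝔤) (coboundary D.r) :=
  isLieCobracket_coboundary (separatingLeft_baseChange F D.B_nondegenerate.1)
    (lieInvariant_baseChange F D.B_invariant) D.BF_f_add_BF_f fun _ hp _ hq =>
      lie_mem_range_cayley_of_span (fun _ h => h.mem_graph) D.span_gen
        (fun _ h _ h' => h.lie_mem_graph h') hp hq

end BDData

/-! ### Transport of coboundary structures -/

section Transport

variable {k L L' : Type*} [Field k] [LieRing L] [LieAlgebra k L] [LieRing L'] [LieAlgebra k L']

theorem map_lie_tensor (θ : L →ₗ⁅k⁆ L') (x : L) (t : L ⊗[k] L) :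
    TensorProduct.map (θ : L →ₗ[k] L') (θ : L →ₗ[k] L') ⁅x, t⁆
      = ⁅θ x, TensorProduct.map (θ : L →ₗ[k] L') (θ : L →ₗ[k] L') t⁆ := by
  induction t using TensorProduct.induction_on with
  | zero => simp
  | add s t hs ht => simp only [lie_add, map_add, hs, ht]
  | tmul u v => simp [TensorProduct.LieModule.lie_tmul_right]

theorem cyc_map (θ : L →ₗ[k] L') (t : L ⊗[k] (L ⊗[k] L)) :
    cyc k L' (TensorProduct.map θ (TensorProduct.map θ θ) t)
      = TensorProduct.map θ (TensorProduct.map θ θ) (cyc k L t) := by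
  induction t using TensorProduct.induction_on with
  | zero => simp
  | add s t hs ht => simp only [map_add, hs, ht]
  | tmul u t =>
    induction t using TensorProduct.induction_on with
    | zero => simp
    | add s t hs ht => simp only [TensorProduct.tmul_add, map_add, hs, ht]
    | tmul v w => simp [cyc]

variable {t : L ⊗[k] L}

theorem IsLieCobracket.smul (h : IsLieCobracket k L (coboundary t)) (a : k) :
    IsLieCobracket k L (coboundary (a • t)) := by
  have ha : coboundary (a • t) = a • coboundary t := map_smul _ a t
  refine ⟨fun x => ?_, fun x => ?_, coboundary_lie _⟩
  · rw [ha, LinearMap.smul_apply, map_smul, h.skew, smul_neg]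
  · simp only [ha, LinearMap.lTensor_smul, LinearMap.smul_apply, map_smul, ← smul_add,
      h.coJacobi, smul_zero]

theorem IsLieCobracket.map (h : IsLieCobracket k L (coboundary t)) (θ : L ≃ₗ⁅k⁆ L') :
    IsLieCobracket k L'
      (coboundary (TensorProduct.map (θ : L →ₗ[k] L') (θ : L →ₗ[k] L') t)) := by
  set θ' : L →ₗ[k] L' := (θ : L →ₗ[k] L')
  set δ' := coboundary (TensorProduct.map θ' θ' t)
  have hδ (x : L) : δ' (θ' x) = TensorProduct.map θ' θ' (coboundary t x) :=
    (map_lie_tensor θ.toLieHom x t).symm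
  have hδδ (s : L ⊗[k] L) : δ'.lTensor L' (TensorProduct.map θ' θ' s)
      = TensorProduct.map θ' (TensorProduct.map θ' θ') ((coboundary t).lTensor L s) := by
    induction s using TensorProduct.induction_on with
    | zero => simp
    | add s s' hs hs' => simp only [map_add, hs, hs']
    | tmul u v => simp only [TensorProduct.map_tmul, LinearMap.lTensor_tmul, hδ]
  refine ⟨θ.surjective.forall.2 fun x => ?_, θ.surjective.forall.2 fun x => ?_, coboundary_lie _⟩
  · change TensorProduct.comm k L' L' (δ' (θ' x)) = -δ' (θ' x)
    rw [hδ, ← TensorProduct.map_comm, h.skew, map_neg]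
  · change δ'.lTensor L' (δ' (θ' x)) + cyc k L' (δ'.lTensor L' (δ' (θ' x)))
      + cyc k L' (cyc k L' (δ'.lTensor L' (δ' (θ' x)))) = 0
    rw [hδ, hδδ, cyc_map, cyc_map, ← map_add, ← map_add, h.coJacobi, map_zero]

end Transport

/-! ### The adjoint action -/

namespace LinAlgGroup.Corresponds

variable {n : ℕ} {G : LinAlgGroup n} {𝔤 : Type*} [LieRing 𝔤] [LieAlgebra ℂ 𝔤]
  (c : G.Corresponds 𝔤) {S S' : Type} [Field S] [Algebra ℂ S] [Field S'] [Algebra ℂ S']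

theorem ιExt_lie (x y : S ⊗[ℂ] 𝔤) :
    c.ιExt S ⁅x, y⁆ = c.ιExt S x * c.ιExt S y - c.ιExt S y * c.ιExt S x := by
  induction x using TensorProduct.induction_on with
  | zero => simp
  | add x x' h h' => simp only [add_lie, map_add, h, h', add_mul, mul_add]; abel
  | tmul s x =>
    induction y using TensorProduct.induction_on with
    | zero => simp
    | add y y' h h' => simp only [lie_add, map_add, h, h', add_mul, mul_add]; abel
    | tmul s' y =>
      rw [LieAlgebra.ExtendScalars.bracket_tmul, ιExt_tmul, ιExt_tmul, ιExt_tmul, c.map_lie,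
        Matrix.map_sub _ (map_sub (algebraMap ℂ S)), Matrix.map_mul, Matrix.map_mul,
        smul_mul_smul_comm, smul_mul_smul_comm, mul_comm s' s, smul_sub]

theorem Ad_lie (X : G.points S) (x y : S ⊗[ℂ] 𝔤) :
    c.Ad S X ⁅x, y⁆ = ⁅c.Ad S X x, c.Ad S X y⁆ := by
  apply c.ιExt_injective S
  have hconj (A B : Matrix (Fin n) (Fin n) S) :
      (X.1.val * A * X.1⁻¹.val) * (X.1.val * B * X.1⁻¹.val) = X.1.val * (A * B) * X.1⁻¹.val := by
    simp only [mul_assoc, Units.inv_mul_cancel_left]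
  simp only [ιExt_Ad, ιExt_lie, hconj, mul_sub, sub_mul]

theorem Ad_mul (X Y : G.points S) (x : S ⊗[ℂ] 𝔤) :
    c.Ad S (X * Y) x = c.Ad S X (c.Ad S Y x) := by
  apply c.ιExt_injective S
  simp only [ιExt_Ad, Subgroup.coe_mul, mul_inv_rev, Units.val_mul, mul_assoc]

theorem Ad_one (x : S ⊗[ℂ] 𝔤) : c.Ad S (1 : G.points S) x = x := by
  apply c.ιExt_injective S
  simp [ιExt_Ad]

/-- The adjoint action of a point of `G`, as an automorphism of the Lie algebra `𝔤(S)`. -/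
def AdEquiv (X : G.points S) : (S ⊗[ℂ] 𝔤) ≃ₗ⁅S⁆ (S ⊗[ℂ] 𝔤) :=
  { c.Ad S X with
    map_lie' := c.Ad_lie X _ _
    invFun := c.Ad S X⁻¹
    left_inv x := (c.Ad_mul X⁻¹ X x).symm.trans (by rw [inv_mul_cancel, Ad_one])
    right_inv x := (c.Ad_mul X X⁻¹ x).symm.trans (by rw [mul_inv_cancel, Ad_one]) }

theorem Ad₂_mul (X Y : G.points S) (t : (S ⊗[ℂ] 𝔤) ⊗[S] (S ⊗[ℂ] 𝔤)) :
    c.Ad₂ S (X * Y) t = c.Ad₂ S X (c.Ad₂ S Y t) := by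
  have h : c.Ad S (X * Y) = c.Ad S X ∘ₗ c.Ad S Y := LinearMap.ext (c.Ad_mul X Y)
  rw [Ad₂, h, TensorProduct.map_comp]
  rfl

theorem Ad₂_one (t : (S ⊗[ℂ] 𝔤) ⊗[S] (S ⊗[ℂ] 𝔤)) : c.Ad₂ S (1 : G.points S) t = t := by
  have h : c.Ad S (1 : G.points S) = LinearMap.id := LinearMap.ext c.Ad_one
  rw [Ad₂, h, TensorProduct.map_id]
  rfl

theorem Ad₂_inv_mul_eq_iff {X Y : G.points S} {t u : (S ⊗[ℂ] 𝔤) ⊗[S] (S ⊗[ℂ] 𝔤)} :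
    c.Ad₂ S (X⁻¹ * Y) t = u ↔ c.Ad₂ S Y t = c.Ad₂ S X u := by
  rw [Ad₂_mul]
  constructor
  · rintro rfl
    rw [← Ad₂_mul, mul_inv_cancel, Ad₂_one]
  · intro h
    rw [h, ← Ad₂_mul, inv_mul_cancel, Ad₂_one]

theorem ιExt_scal₁ (φ : S →ₐ[ℂ] S') (x : S ⊗[ℂ] 𝔤) :
    c.ιExt S' (scal₁ 𝔤 φ x) = (c.ιExt S x).map φ := by
  induction x using TensorProduct.induction_on with
  | zero => simp [Matrix.map_zero]
  | add x y hx hy => rw [map_add, map_add, map_add, hx, hy, Matrix.map_add _ (map_add φ)]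
  | tmul s x =>
    ext i j
    simp [ιExt_tmul]

theorem scal₁_Ad (φ : S →ₐ[ℂ] S') (X : G.points S) (x : S ⊗[ℂ] 𝔤) :
    scal₁ 𝔤 φ (c.Ad S X x) = c.Ad S' (G.mapPoints φ X) (scal₁ 𝔤 φ x) := by
  apply c.ιExt_injective S'
  rw [ιExt_Ad, ιExt_scal₁, ιExt_scal₁, ιExt_Ad, Matrix.map_mul, Matrix.map_mul]
  rfl

theorem scal₂_Ad₂ (φ : S →ₐ[ℂ] S') (X : G.points S) (t : (S ⊗[ℂ] 𝔤) ⊗[S] (S ⊗[ℂ] 𝔤)) :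
    scal₂ 𝔤 φ (c.Ad₂ S X t) = c.Ad₂ S' (G.mapPoints φ X) (scal₂ 𝔤 φ t) := by
  induction t using TensorProduct.induction_on with
  | zero => simp
  | add s t hs ht => simp only [map_add, hs, ht]
  | tmul u v => simp [Ad₂, scal₁_Ad]

theorem comm_Ad₂ (X : G.points S) (t : (S ⊗[ℂ] 𝔤) ⊗[S] (S ⊗[ℂ] 𝔤)) :
    TensorProduct.comm S _ _ (c.Ad₂ S X t) = c.Ad₂ S X (TensorProduct.comm S _ _ t) :=
  (TensorProduct.map_comm _ _ t).symm

theorem isLieCobracket_coboundary_Ad₂ {t : (S ⊗[ℂ] 𝔤) ⊗[S] (S ⊗[ℂ] 𝔤)}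
    (ht : IsLieCobracket S (S ⊗[ℂ] 𝔤) (coboundary t)) (X : G.points S) :
    IsLieCobracket S (S ⊗[ℂ] 𝔤) (coboundary (c.Ad₂ S X t)) :=
  ht.map (c.AdEquiv X)

theorem Ad₂_casimir [FiniteDimensional ℂ 𝔤] [LieAlgebra.IsSimple ℂ 𝔤]
    {B : LinearMap.BilinForm ℂ 𝔤} (hsep : B.SeparatingLeft) (hB : B.lieInvariant 𝔤)
    {Ω : (S ⊗[ℂ] 𝔤) ⊗[S] (S ⊗[ℂ] 𝔤)} (hΩ : tensorOp (B.baseChange S) Ω = LinearMap.id)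
    (X : G.points S) : c.Ad₂ S X Ω = Ω := by
  refine tensorOp_injective (separatingLeft_baseChange S hsep) <| LinearMap.ext <|
    (c.AdEquiv X).surjective.forall.2 fun x => ?_
  refine (tensorOp_map (baseChange_apply_lieEquiv hB (c.AdEquiv X)) Ω x).trans ?_
  rw [hΩ]
  rfl

end LinAlgGroup.Corresponds

/-! ### Invariant tensors -/

section Invariants

variable {k E E' L : Type*} [CommRing k] [Field E] [Field E'] [Algebra k E] [Algebra k E']
  [LieRing L] [LieAlgebra k L]

variable (E L) in
/-- The invariants of `E ⊗ L` in its tensor square, as a subspace over `E`. -/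
def invariants : Submodule E ((E ⊗[k] L) ⊗[E] (E ⊗[k] L)) :=
  (LieModule.maxTrivSubmodule E (E ⊗[k] L) ((E ⊗[k] L) ⊗[E] (E ⊗[k] L))).toSubmodule

theorem mem_invariants {t : (E ⊗[k] L) ⊗[E] (E ⊗[k] L)} :
    t ∈ invariants E L ↔ ∀ x : E ⊗[k] L, ⁅x, t⁆ = 0 :=
  LieModule.mem_maxTrivSubmodule E _ _ t

theorem mem_invariants_iff_scal₁ (φ : E →ₐ[k] E') {t : (E' ⊗[k] L) ⊗[E'] (E' ⊗[k] L)} :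
    t ∈ invariants E' L ↔ ∀ x, ⁅scal₁ L φ x, t⁆ = 0 :=
  ⟨fun h _ => mem_invariants.1 h _, fun h => mem_invariants.2 <| LinearMap.congr_fun
    (linearMap_ext_scal₁ φ (f := coboundary t) (g := 0) h)⟩

theorem scal₂_mem_invariants (φ : E →ₐ[k] E') {t : (E ⊗[k] L) ⊗[E] (E ⊗[k] L)}
    (ht : t ∈ invariants E L) : scal₂ L φ t ∈ invariants E' L :=
  (mem_invariants_iff_scal₁ φ).2 fun _ => by rw [← scal₂_lie, mem_invariants.1 ht, map_zero]

theorem tensorOp_baseChange_scal₂_eq_id (φ : E →ₐ[k] E') {B : LinearMap.BilinForm k L}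
    {Ω : (E ⊗[k] L) ⊗[E] (E ⊗[k] L)} (hΩ : tensorOp (B.baseChange E) Ω = LinearMap.id) :
    tensorOp (B.baseChange E') (scal₂ L φ Ω) = LinearMap.id :=
  linearMap_ext_scal₁ φ fun x => by rw [tensorOp_baseChange_scal₂, hΩ]; rfl

end Invariants

section Casimir

variable {k E L : Type*} [Field k] [Field E] [Algebra k E] [LieRing L] [LieAlgebra k L]
  [FiniteDimensional k L] {B : LinearMap.BilinForm k L} {Ω t u v : (E ⊗[k] L) ⊗[E] (E ⊗[k] L)}
  (hsep : B.SeparatingLeft) (hB : B.lieInvariant L)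
  (hΩ : tensorOp (B.baseChange E) Ω = LinearMap.id)

include hsep hB hΩ

theorem casimir_mem_invariants : Ω ∈ invariants E L :=
  mem_invariants.2 fun x => tensorOp_injective (separatingLeft_baseChange E hsep) <|
    LinearMap.ext fun y => by
      rw [tensorOp_lie (lieInvariant_baseChange E hB), hΩ, map_zero]
      exact sub_self _

variable [IsAlgClosed k] [CharZero k] [LieAlgebra.IsSimple k L]

theorem eq_zero_of_mem_invariants_of_comm_eq_neg (hcomm : TensorProduct.comm E _ _ Ω = Ω)
    (ht : t ∈ invariants E L) (hskew : TensorProduct.comm E _ _ t = -t) : t = 0 := by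
  have : CharZero E := charZero_of_injective_algebraMap (algebraMap k E).injective
  obtain ⟨c, rfl⟩ := exists_eq_smul_of_invariant hsep hB hΩ fun x => mem_invariants.1 ht _
  rw [map_smul, hcomm, eq_neg_iff_add_eq_zero, ← two_smul E] at hskew
  exact (smul_eq_zero.1 hskew).resolve_left two_ne_zero

theorem sub_mem_invariants_iff (hu : u + TensorProduct.comm E _ _ u = Ω)
    (hv : v + TensorProduct.comm E _ _ v = Ω) : u - v ∈ invariants E L ↔ u = v := by
  refine ⟨fun h => sub_eq_zero.1 ?_, fun h => by rw [h, sub_self]; exact zero_mem _⟩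
  refine eq_zero_of_mem_invariants_of_comm_eq_neg hsep hB hΩ ?_ h ?_
  · rw [← hu, map_add, TensorProduct.comm_comm, add_comm]
  · rw [map_sub, eq_sub_of_add_eq' hu, eq_sub_of_add_eq' hv]
    abel

theorem add_mem_invariants_iff (hu : u + TensorProduct.comm E _ _ u = Ω)
    (hv : v + TensorProduct.comm E _ _ v = Ω) :
    u + v ∈ invariants E L ↔ u = TensorProduct.comm E _ _ v := by
  have hv' : TensorProduct.comm E _ _ v + TensorProduct.comm E _ _ (TensorProduct.comm E _ _ v)
      = Ω := by rw [TensorProduct.comm_comm, add_comm, hv]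
  have hsum : u + v = u - TensorProduct.comm E _ _ v + Ω := by
    rw [← hv]
    abel
  have hmem := casimir_mem_invariants hsep hB hΩ
  rw [hsum, Submodule.add_mem_iff_left _ hmem, sub_mem_invariants_iff hsep hB hΩ hu hv']

end Casimir

/-! ### Galois descent -/

section Descent

variable {F E 𝔤 : Type*} [Field F] [Field E] [Algebra ℂ F] [Algebra ℂ E] [Algebra F E]
  [IsScalarTower ℂ F E] [LieRing 𝔤] [LieAlgebra ℂ 𝔤]

theorem restrictScalars_comp_toAlgHom (τ : E ≃ₐ[F] E) :
    (τ.toAlgHom.restrictScalars ℂ).comp (IsScalarTower.toAlgHom ℂ F E)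
      = IsScalarTower.toAlgHom ℂ F E :=
  AlgHom.ext fun z => τ.commutes z

theorem scal₁_ext₁ (τ : E ≃ₐ[F] E) (x : F ⊗[ℂ] 𝔤) :
    scal₁ 𝔤 (τ.toAlgHom.restrictScalars ℂ) (ext₁ F E 𝔤 x) = ext₁ F E 𝔤 x := by
  rw [ext₁_eq_scal₁, scal₁_scal₁, restrictScalars_comp_toAlgHom]

theorem scal₂_ext₂ (τ : E ≃ₐ[F] E) (t : (F ⊗[ℂ] 𝔤) ⊗[F] (F ⊗[ℂ] 𝔤)) :
    scal₂ 𝔤 (τ.toAlgHom.restrictScalars ℂ) (ext₂ F E 𝔤 t) = ext₂ F E 𝔤 t := by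
  rw [ext₂_eq_scal₂, scal₂_scal₂, restrictScalars_comp_toAlgHom]

theorem mem_range_ext₂ [IsGalois F E] {t : (E ⊗[ℂ] 𝔤) ⊗[E] (E ⊗[ℂ] 𝔤)}
    (ht : ∀ τ : E ≃ₐ[F] E, scal₂ 𝔤 (τ.toAlgHom.restrictScalars ℂ) t = t) :
    t ∈ LinearMap.range (ext₂ F E 𝔤) := by
  let b := Module.Free.chooseBasis ℂ 𝔤
  obtain ⟨t', rfl⟩ := mem_range_of_map_basis (x := t)
    (scal₂_tensorProduct_baseChange (IsScalarTower.toAlgHom ℂ F E) b) fun i =>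
      (InfiniteGalois.mem_range_algebraMap_iff_fixed _).2 fun τ => by
        conv_rhs => rw [← ht τ]
        exact (repr_apply_of_map_basis
          (scal₂_tensorProduct_baseChange (τ.toAlgHom.restrictScalars ℂ) b) t i).symm
  exact ⟨t', ext₂_eq_scal₂ t'⟩

variable {s : (E ⊗[ℂ] 𝔤) ⊗[E] (E ⊗[ℂ] 𝔤)}

theorem scal₂_sub_mem_invariants_iff (τ : E ≃ₐ[F] E) :
    scal₂ 𝔤 (τ.toAlgHom.restrictScalars ℂ) s - s ∈ invariants E 𝔤 ↔
      ∀ x, scal₂ 𝔤 (τ.toAlgHom.restrictScalars ℂ) ⁅ext₁ F E 𝔤 x, s⁆ = ⁅ext₁ F E 𝔤 x, s⁆ := by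
  simp only [mem_invariants_iff_scal₁ (IsScalarTower.toAlgHom ℂ F E), ← ext₁_eq_scal₁, lie_sub,
    sub_eq_zero, scal₂_lie, scal₁_ext₁]

theorem definesLieBialgebra_iff [IsGalois F E]
    (hs : IsLieCobracket E (E ⊗[ℂ] 𝔤) (coboundary s)) :
    DefinesLieBialgebra F E 𝔤 s ↔ ∀ τ : E ≃ₐ[F] E,
      scal₂ 𝔤 (τ.toAlgHom.restrictScalars ℂ) s - s ∈ invariants E 𝔤 := by
  simp only [scal₂_sub_mem_invariants_iff]
  constructor
  · rintro ⟨δ, -, hδ⟩ τ x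
    rw [← hδ, scal₂_ext₂]
  · intro h
    have hinj : Function.Injective (ext₂ F E 𝔤) := by
      simpa only [Function.Injective, ext₂_eq_scal₂] using
        scal₂_injective (IsScalarTower.toAlgHom ℂ F E).injective
    let δ : F ⊗[ℂ] 𝔤 →ₗ[F] (F ⊗[ℂ] 𝔤) ⊗[F] (F ⊗[ℂ] 𝔤) :=
      (LinearEquiv.ofInjective (ext₂ F E 𝔤) hinj).symm.toLinearMap ∘ₗ
        ((coboundary s).restrictScalars F ∘ₗ ext₁ F E 𝔤).codRestrict _
          fun x => mem_range_ext₂ fun τ => h τ x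
    have hδ (x : F ⊗[ℂ] 𝔤) : ext₂ F E 𝔤 (δ x) = ⁅ext₁ F E 𝔤 x, s⁆ :=
      congrArg Subtype.val (LinearEquiv.apply_symm_apply (LinearEquiv.ofInjective _ hinj) _)
    exact ⟨δ, .of_scal₂ (fun x => (ext₂_eq_scal₂ _).symm.trans (hδ x)) hs, hδ⟩

theorem scal₂_mul_sub_mem_invariants {σ τ : E ≃ₐ[F] E}
    (hσ : scal₂ 𝔤 (σ.toAlgHom.restrictScalars ℂ) s - s ∈ invariants E 𝔤)
    (hτ : scal₂ 𝔤 (τ.toAlgHom.restrictScalars ℂ) s - s ∈ invariants E 𝔤) :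
    scal₂ 𝔤 ((σ * τ).toAlgHom.restrictScalars ℂ) s - s ∈ invariants E 𝔤 := by
  convert add_mem (scal₂_mem_invariants (σ.toAlgHom.restrictScalars ℂ) hτ) hσ using 1
  rw [map_sub, scal₂_scal₂, sub_add_sub_cancel]
  rfl

end Descent

section Quadratic

variable {F E : Type*} [Field F] [Field E] [Algebra F E] {y : E}

theorem apply_eq_of_mem_adjoin {τ : E ≃ₐ[F] E} (h : τ y = y) {z : E} (hz : z ∈ F⟮y⟯) :
    τ z = z :=
  AlgHom.congr_fun (algHom_ext_of_eq_adjoin F (S := F⟮y⟯) rfl (φ₁ := τ.toAlgHom.comp F⟮y⟯.val)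
    (φ₂ := F⟮y⟯.val) fun _ hx => by obtain rfl := hx; exact h) ⟨z, hz⟩

theorem apply_eq_or_eq_neg {w : F} (hy : y ^ 2 = algebraMap F E w) (τ : E ≃ₐ[F] E) :
    τ y = y ∨ τ y = -y := by
  rw [← sq_eq_sq_iff_eq_or_eq_neg, ← map_pow, hy, τ.commutes]

theorem apply_ne_of_ne_one {σ₀ : F⟮y⟯ ≃ₐ[F] F⟮y⟯} (hσ₀ : σ₀ ≠ 1) {σ : E ≃ₐ[F] E}
    (hσ : ∀ z : F⟮y⟯, σ z = σ₀ z) : σ y ≠ y := fun h =>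
  hσ₀ <| AlgEquiv.ext fun z => Subtype.ext <| (hσ z).symm.trans (apply_eq_of_mem_adjoin h z.2)

theorem restrictScalars_apply_gen (τ : E ≃ₐ[F⟮y⟯] E) : τ.restrictScalars F y = y :=
  τ.commutes (AdjoinSimple.gen F y)

theorem exists_restrictScalars_eq {τ : E ≃ₐ[F] E} (h : τ y = y) :
    ∃ τ' : E ≃ₐ[F⟮y⟯] E, τ'.restrictScalars F = τ :=
  ⟨.ofRingEquiv (f := τ.toRingEquiv) fun z => apply_eq_of_mem_adjoin h z.2, rfl⟩

theorem forall_algEquiv_iff_of_sq_eq {w : F} (hy : y ^ 2 = algebraMap F E w) {σ : E ≃ₐ[F] E}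
    (hσ : σ y = -y) {P : (E ≃ₐ[F] E) → Prop} (hP : ∀ τ τ', P τ → P τ' → P (τ * τ')) :
    (∀ τ, P τ) ↔ (∀ τ : E ≃ₐ[F⟮y⟯] E, P (τ.restrictScalars F)) ∧ P σ := by
  refine ⟨fun h => ⟨fun τ => h _, h σ⟩, fun ⟨hfix, hPσ⟩ τ => ?_⟩
  have hfix' {τ : E ≃ₐ[F] E} (hτ : τ y = y) : P τ := by
    obtain ⟨τ, rfl⟩ := exists_restrictScalars_eq hτ
    exact hfix τ
  obtain hτ | hτ := apply_eq_or_eq_neg hy τ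
  · exact hfix' hτ
  · rw [← mul_inv_cancel_left σ τ]
    refine hP _ _ hPσ (hfix' (σ.injective ?_))
    rw [← AlgEquiv.mul_apply, mul_inv_cancel_left, hτ, hσ]

variable [Algebra ℂ F] [Algebra ℂ E] [IsScalarTower ℂ F E] [IsGalois F E] {𝔤 : Type*} [LieRing 𝔤]
  [LieAlgebra ℂ 𝔤] {s : (E ⊗[ℂ] 𝔤) ⊗[E] (E ⊗[ℂ] 𝔤)}

theorem definesLieBialgebra_iff_of_sq_eq {w : F} (hy : y ^ 2 = algebraMap F E w) {σ : E ≃ₐ[F] E}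
    (hσ : σ y = -y) (hs : IsLieCobracket E (E ⊗[ℂ] 𝔤) (coboundary s)) :
    DefinesLieBialgebra F E 𝔤 s ↔
      (∀ τ : E ≃ₐ[F⟮y⟯] E,
        scal₂ 𝔤 ((τ.restrictScalars F).toAlgHom.restrictScalars ℂ) s - s ∈ invariants E 𝔤) ∧
      scal₂ 𝔤 (σ.toAlgHom.restrictScalars ℂ) s - s ∈ invariants E 𝔤 :=
  (definesLieBialgebra_iff hs).trans <| forall_algEquiv_iff_of_sq_eq hy hσ
    (P := fun τ => scal₂ 𝔤 (τ.toAlgHom.restrictScalars ℂ) s - s ∈ invariants E 𝔤)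
    fun _ _ => scal₂_mul_sub_mem_invariants

end Quadratic

/-! ### Twists of an r-matrix -/

section Twist

variable {E : Type} [Field E] [Algebra ℂ E] {𝔤 : Type*} [LieRing 𝔤] [LieAlgebra ℂ 𝔤]
  [FiniteDimensional ℂ 𝔤] [LieAlgebra.IsSimple ℂ 𝔤] {B : LinearMap.BilinForm ℂ 𝔤}
  {n : ℕ} {G : LinAlgGroup n} (c : G.Corresponds 𝔤) {r : (E ⊗[ℂ] 𝔤) ⊗[E] (E ⊗[ℂ] 𝔤)}
  (hsep : B.SeparatingLeft) (hB : B.lieInvariant 𝔤)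
  (hr : tensorOp (B.baseChange E) (r + TensorProduct.comm E _ _ r) = LinearMap.id)

include hsep hB hr

theorem Ad₂_add_comm_Ad₂ (X : G.points E) :
    c.Ad₂ E X r + TensorProduct.comm E _ _ (c.Ad₂ E X r) = r + TensorProduct.comm E _ _ r := by
  rw [c.comm_Ad₂, ← map_add, c.Ad₂_casimir hsep hB hr]

variable {φ : E →ₐ[ℂ] E} (hφ : scal₂ 𝔤 φ r = r) {a : E} (ha : a ≠ 0) (X : G.points E)

include hφ ha

theorem scal₂_smul_Ad₂_sub_mem_invariants_iff_of_apply_eq (hφa : φ a = a) :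
    scal₂ 𝔤 φ (a • c.Ad₂ E X r) - a • c.Ad₂ E X r ∈ invariants E 𝔤 ↔
      c.Ad₂ E (X⁻¹ * G.mapPoints φ X) r = r := by
  rw [map_smulₛₗ, RingHom.coe_coe, hφa, c.scal₂_Ad₂, hφ, ← smul_sub, Submodule.smul_mem_iff _ ha,
    sub_mem_invariants_iff hsep hB hr (Ad₂_add_comm_Ad₂ c hsep hB hr _)
      (Ad₂_add_comm_Ad₂ c hsep hB hr _), c.Ad₂_inv_mul_eq_iff]

theorem scal₂_smul_Ad₂_sub_mem_invariants_iff_of_apply_eq_neg (hφa : φ a = -a) :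
    scal₂ 𝔤 φ (a • c.Ad₂ E X r) - a • c.Ad₂ E X r ∈ invariants E 𝔤 ↔
      c.Ad₂ E (X⁻¹ * G.mapPoints φ X) r = TensorProduct.comm E _ _ r := by
  rw [map_smulₛₗ, RingHom.coe_coe, hφa, c.scal₂_Ad₂, hφ, neg_smul, ← neg_add', ← smul_add,
    neg_mem_iff, Submodule.smul_mem_iff _ ha,
    add_mem_invariants_iff hsep hB hr (Ad₂_add_comm_Ad₂ c hsep hB hr _)
      (Ad₂_add_comm_Ad₂ c hsep hB hr _), c.Ad₂_inv_mul_eq_iff, c.comm_Ad₂]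

end Twist

namespace BDData

variable {𝔤 : Type*} [LieRing 𝔤] [LieAlgebra ℂ 𝔤] [FiniteDimensional ℂ 𝔤]
  [LieAlgebra.IsSimple ℂ 𝔤] {F : Type*} [Field F] [Algebra ℂ F] (D : BDData 𝔤 F) (E : Type*)
  [Field E] [Algebra ℂ E] [Algebra F E] [IsScalarTower ℂ F E]

theorem isLieCobracket_ext₂_r :
    IsLieCobracket E (E ⊗[ℂ] 𝔤) (coboundary (ext₂ F E 𝔤 D.r)) := by
  rw [ext₂_eq_scal₂]
  exact isLieCobracket_coboundary_scal₂ D.isLieCobracket_r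

theorem tensorOp_ext₂_r_add_comm : tensorOp (D.B.baseChange E)
    (ext₂ F E 𝔤 D.r + TensorProduct.comm E _ _ (ext₂ F E 𝔤 D.r)) = LinearMap.id := by
  rw [ext₂_eq_scal₂, ← scal₂_comm, ← map_add]
  exact tensorOp_baseChange_scal₂_eq_id _ D.tensorOp_r_add_comm

end BDData

end TwistedBD

end

theorem mainTheorem3_general {F : Type*} {E : Type} [Field F] [Field E] [Algebra ℂ F]
    [Algebra ℂ E] [Algebra F E] [IsScalarTower ℂ F E] [IsGalois F E] {𝔤 : Type*} [LieRing 𝔤]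
    [LieAlgebra ℂ 𝔤] [FiniteDimensional ℂ 𝔤] [LieAlgebra.IsSimple ℂ 𝔤] {n : ℕ} {G : LinAlgGroup n}
    (c : G.Corresponds 𝔤) (D : BDData 𝔤 F) {y : E} {w : F} (hy : y ^ 2 = algebraMap F E w)
    {a : E} (ha : ∃ k : F, k ≠ 0 ∧ a = algebraMap F E k * y) (X : G.points E)
    {σ₀ : F⟮y⟯ ≃ₐ[F] F⟮y⟯} (hσ₀ : σ₀ ≠ 1) {σ : E ≃ₐ[F] E} (hσ : ∀ z : F⟮y⟯, σ z = σ₀ z) :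
    DefinesLieBialgebra F E 𝔤 (a • c.Ad₂ E X (ext₂ F E 𝔤 D.r)) ↔
      (∀ τ : E ≃ₐ[F⟮y⟯] E, c.Ad₂ E
        (X⁻¹ * G.mapPoints ((τ.restrictScalars F).toAlgHom.restrictScalars ℂ) X) (ext₂ F E 𝔤 D.r)
          = ext₂ F E 𝔤 D.r) ∧
      c.Ad₂ E (X⁻¹ * G.mapPoints (σ.toAlgHom.restrictScalars ℂ) X) (ext₂ F E 𝔤 D.r)
        = TensorProduct.comm E _ _ (ext₂ F E 𝔤 D.r) := by
  obtain ⟨k, hk, rfl⟩ := ha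
  have hσy : σ y = -y := (apply_eq_or_eq_neg hy σ).resolve_left (apply_ne_of_ne_one hσ₀ hσ)
  have hy0 : y ≠ 0 := fun h => apply_ne_of_ne_one hσ₀ hσ (by rw [h, map_zero])
  have ha : algebraMap F E k * y ≠ 0 := mul_ne_zero ((map_ne_zero _).2 hk) hy0
  have hcasimir := D.tensorOp_ext₂_r_add_comm E
  have hcobracket := (c.isLieCobracket_coboundary_Ad₂ (D.isLieCobracket_ext₂_r E) X).smul
    (algebraMap F E k * y)
  refine (definesLieBialgebra_iff_of_sq_eq hy hσy hcobracket).trans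
    (and_congr (forall_congr' fun τ => ?_) ?_)
  · have hτ : τ.restrictScalars F (algebraMap F E k * y) = algebraMap F E k * y := by
      rw [map_mul, AlgEquiv.commutes, restrictScalars_apply_gen]
    exact scal₂_smul_Ad₂_sub_mem_invariants_iff_of_apply_eq c D.B_nondegenerate.1 D.B_invariant
      hcasimir (scal₂_ext₂ _ _) ha X hτ
  · have hσa : σ (algebraMap F E k * y) = -(algebraMap F E k * y) := by
      rw [map_mul, AlgEquiv.commutes, hσy, mul_neg]
    exact scal₂_smul_Ad₂_sub_mem_invariants_iff_of_apply_eq_neg c D.B_nondegenerate.1 D.B_invariant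
      hcasimir (scal₂_ext₂ _ _) ha X hσa

theorem mainTheorem3 {𝔤 : Type*} [LieRing 𝔤] [LieAlgebra ℂ 𝔤] [FiniteDimensional ℂ 𝔤]
    [LieAlgebra.IsSimple ℂ 𝔤] {n : ℕ} {G : LinAlgGroup n} (c : G.Corresponds 𝔤)
    (D : BDData 𝔤 K) (sqrtħ : Kbar) (hsqrt : sqrtħ ^ 2 = algebraMap K Kbar hbar)
    (a : Kbar) (ha : ∃ k : K, k ≠ 0 ∧ a = algebraMap K Kbar k * sqrtħ)
    (X : G.points Kbar)
    (σ₀ : K⟮sqrtħ⟯ ≃ₐ[K] K⟮sqrtħ⟯) (hσ₀ : σ₀ ≠ 1)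
    (σ : Kbar ≃ₐ[K] Kbar) (hσ : ∀ z : K⟮sqrtħ⟯, σ z = σ₀ z) :
    DefinesLieBialgebra K Kbar 𝔤 (a • c.Ad₂ Kbar X (ext₂ K Kbar 𝔤 D.r)) ↔
      IsNontwistedCocycle c K⟮sqrtħ⟯ (ext₂ K Kbar 𝔤 D.r) X ∧
      c.Ad₂ Kbar (X⁻¹ * galAct G σ X) (ext₂ K Kbar 𝔤 D.r)
        = TensorProduct.comm Kbar _ _ (ext₂ K Kbar 𝔤 D.r) :=
  have : CharZero K := charZero_of_injective_algebraMap (algebraMap ℂ K).injective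
  mainTheorem3_general c D hsqrt ha X hσ₀ hσ
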